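/- **Algorithm.** Sketched-SGD with $W$ workers on $f:\mathbb R^d\to\mathbb R$ starts from a point $w_1$ with zero errors $a_0^i=0$ and performs, for $t=1,\dots,T$, with $\eta_t=\gamma/(t+\xi)$: (1) worker $i$ computes a stochastic gradient $g_t^i$ at $w_t$ from a fresh sample and sets $\bar a_t^i=\eta_t g_t^i+a_{t-1}^i$; (2) worker $i$ sends a Count Sketch of $\bar a^i_t$; the server averages the sketches, obtaining a sketch $S_t$ of $\bar a_t=\frac1W\sum_i\bar a_t^i$; (3) HeavyMix: from $S_t$ the server computes the estimates $\hat a_j$ of the coordinates of $\bar a_t$ (median over the rows of the signed bucket contents) and $\hat\ell^2$ of $\|\bar a_t\|^2$ (median over the rows of the squared norm of the row), sets $H=\{j:\hat a_j^2\ge\hat\ell^2/k\}$, and takes a set $\mathrm{Top}$ of exactly $k$ coordinates: $H$ together with $k-|H|$ uniformly random coordinates outside $H$ (if $|H|>k$, a uniformly random $k$-element subset of $H$). In a second round it requests the exact values on $\mathrm{Top}$; $\tilde g_t$ equals $\bar a_t$ on $\mathrm{Top}$ and $0$ elsewhere; (4) $w_{t+1}=w_t-\tilde g_t$, $\tilde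 g_t$ is sent to the workers, and $a_t^i=\bar a_t^i-\tilde g_t$. The output is $\hat w_T=\frac1{Q_T}\sum_{t=1}^T q_tw_t$ with $q_t=(\xi+t)^2$, $Q_T=\sum_{t=1}^Tq_t$. The hash functions are fresh and independent in each update and each row, and shared by the workers; buckets come from a pairwise independent and signs from a 4-wise independent family. **Theorem.** There are absolute constants $c_1>0$ and $c_2\in\mathbb N_{>0}$ such that the following holds for Sketched-SGD with sketches of $2\lceil c_1\log(dT/\delta)\rceil+1$ rows and $c_2k$ columns, where $0<k\le d$, $W,T\ge1$ and $0<\delta<1$. 1. For all $\beta>4$ and $M$ there is $C>0$, depending only on $\beta$ and $M$, with the following property. Let $f$ be $L$-smooth and $\mu$-strongly convex ($L,\mu>0$) with minimizer $w^*$, and let $\sigma,G\ge 0$. Suppose that $8\le\gamma\mu\le M$ and $$2+\frac{d(1+\beta)}{k(1+\rho)}<\xi\le M\frac dk,\qquad \rho=\frac{4\beta}{(\beta-4)(\beta+1)^2}.$$ Suppose that, given the past, the minibatch gradient $g_t=\frac1W\sum_ig_t^i$ is unbiased for $\nabla f(w_t)$, $\mathbb E\|g_t\|^2\le G^2$ and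 $\mathbb E\|g_t-\nabla f(w_t)\|^2\le\sigma^2$ for each $t\le T$. Then with probability at least $1-\delta$ over the hash functions, $f(\hat w_T)$ is integrable and $$\mathbb E f(\hat w_T)-f(w^*)\le C\Big(\frac{\sigma^2}{\mu T}+\frac{d^2G^2L}{k^2\mu^2T^2}+\frac{d^3G^3}{k^3\mu T^3}\Big),$$ where the expectation is over the samples and the random coordinates in HeavyMix, for fixed hash functions. 2. If every real number is sent with $p\ge 1$ bits and every coordinate index with $\lceil\log_2d\rceil$ bits, and $dT\ge2$, then the total communication (sketches, requests, exact values and sparse updates) in each update is $\Theta(k\log(dT/\delta)\,W)$ bits, with constants depending only on $p$. -/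

import Mathlib

open MeasureTheory

/-- Parameter vectors, with the Euclidean norm. -/
abbrev Vec (d : ℕ) := EuclideanSpace ℝ (Fin d)

/-- `f` is differentiable, `L`-smooth and `μ`-strongly convex. -/
structure SmoothStronglyConvex {d : ℕ} (f : Vec d → ℝ) (L μ : ℝ) : Prop where
  differentiable : Differentiable ℝ f
  smooth : ∀ w₁ w₂ : Vec d, ‖gradient f w₂ - gradient f w₁‖ ≤ L * ‖w₂ - w₁‖
  strong : ∀ w₁ w₂ : Vec d,
    f w₁ + inner ℝ (gradient f w₁) (w₂ - w₁) + μ / 2 * ‖w₂ - w₁‖ ^ 2 ≤ f w₂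

/-! ### Count Sketch -/

/-- A family of functions `h s : ι → β`, with uniformly random seed `s`, is `n`-wise independent:
its values at any at most `n` distinct points are independent and uniform on `β`. -/
def KWiseIndependent {S ι β : Type*} [Fintype S] [Fintype β] (n : ℕ) (h : S → ι → β) : Prop :=
  ∀ I : Finset ι, I.card ≤ n → ∀ v : ι → β,
    Nat.card {s : S // ∀ i ∈ I, h s i = v i} * Fintype.card β ^ I.card = Fintype.card S

/-- The hash functions of one Count Sketch with `2 * n + 1` rows and `B` columns. -/
structure SketchHash (d n B : ℕ) where
  bucket : Fin (2 * n + 1) → Fin d → Fin B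
  sign : Fin (2 * n + 1) → Fin d → ℤˣ

/-- The median of an odd number of reals. -/
noncomputable def median {n : ℕ} (v : Fin (2 * n + 1) → ℝ) : ℝ :=
  v (Tuple.sort v ⟨n, by omega⟩)

namespace SketchHash

variable {d n B : ℕ} (h : SketchHash d n B)

/-- The Count Sketch of `x`: every coordinate is added, with its random sign, to one
bucket of each row. -/
noncomputable def sketch (x : Vec d) : Matrix (Fin (2 * n + 1)) (Fin B) ℝ :=
  fun r b => ∑ i : Fin d, if h.bucket r i = b then ((h.sign r i : ℤ) : ℝ) * x i else 0

/-- The estimate of the `i`-th coordinate from a sketch. -/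
noncomputable def queryCoord (S : Matrix (Fin (2 * n + 1)) (Fin B) ℝ) (i : Fin d) : ℝ :=
  median fun r => ((h.sign r i : ℤ) : ℝ) * S r (h.bucket r i)

/-- The estimate of the squared Euclidean norm from a sketch. -/
noncomputable def queryNormSq (S : Matrix (Fin (2 * n + 1)) (Fin B) ℝ) : ℝ :=
  median fun r => ∑ b : Fin B, S r b ^ 2

open Classical in
/-- The coordinates whose estimated square is at least a `1 / k` fraction of the estimated
squared norm. -/
noncomputable def heavy (k : ℕ) (S : Matrix (Fin (2 * n + 1)) (Fin B) ℝ) : Finset (Fin d) :=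
  Finset.univ.filter fun i => queryNormSq S / (k : ℝ) ≤ h.queryCoord S i ^ 2

end SketchHash

/-! ### The random choice of `k` coordinates -/

/-- A rule that completes (or, if it is too large, cuts down) a set `H` of coordinates to a set of
exactly `k` coordinates.  For a uniformly random rule, the value at a given `H` is uniform among
the `k`-element sets comparable with `H`; when `H` has at most `k` elements it is the
union of `H` and a uniformly random set of `k - |H|` coordinates outside `H`. -/
def Selection (d k : ℕ) : Type :=
  ∀ H : Finset (Fin d), {S : Finset (Fin d) // S.card = k ∧ (S ⊆ H ∨ H ⊆ S)}

noncomputable instance (d k : ℕ) : Fintype (Selection d k) :=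
  inferInstanceAs
    (Fintype (∀ H : Finset (Fin d), {S : Finset (Fin d) // S.card = k ∧ (S ⊆ H ∨ H ⊆ S)}))

instance (d k : ℕ) : MeasurableSpace (Selection d k) := ⊤

/-! ### Sketched-SGD -/

/-- The data of a run of Sketched-SGD with `W` workers, `T` updates and sketches with `2 * n + 1`
rows and `B` columns: the constants of the step size `γ / (t + ξ)`, the initial point, the
stochastic gradient `oracle t i w z` that worker `i` computes at the point `w` from the
sample `z` in update `t`, and the families from which bucket and sign hash functions are drawn. -/
structure SketchedSGD (d W T n B : ℕ) (Z 𝓗 𝓢 : Type*) where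
  γ : ℝ
  ξ : ℝ
  init : Vec d
  oracle : Fin T → Fin W → Vec d → Z → Vec d
  bucketFamily : 𝓗 → Fin d → Fin B
  signFamily : 𝓢 → Fin d → ℤˣ

/-- The model and the accumulated errors of the workers. -/
structure SGDState (d W : ℕ) where
  w : Vec d
  err : Fin W → Vec d

/-- The seeds of all hash functions: fresh in each update, and shared by all workers. -/
abbrev HashSeeds (T n : ℕ) (𝓗 𝓢 : Type*) := Fin T → Fin (2 * n + 1) → 𝓗 × 𝓢

/-- All other randomness: in each update, the data sample and the selection rule. -/
abbrev Samples (d k T : ℕ) (Z : Type*) := Fin T → Z × Selection d k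

/-- Updates are independent; in each update the sample has law `ν` and the selection rule is
independent of it and uniform. -/
noncomputable def samplesLaw (d k T : ℕ) {Z : Type*} [MeasurableSpace Z] (ν : Measure Z) :
    Measure (Samples d k T Z) :=
  Measure.pi fun _ => ν.prod (ProbabilityTheory.uniformOn (Set.univ : Set (Selection d k)))

/-- What is sent in the protocol: real numbers and coordinate indices. -/
inductive Message (d : ℕ) where
  | real (x : ℝ) : Message d
  | index (i : Fin d) : Message d

/-- The length of a message if real numbers are encoded with `p` bits. -/
def Message.bits {d : ℕ} (p : ℕ) : Message d → ℕ
  | .real _ => p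
  | .index _ => Nat.clog 2 d

namespace SketchedSGD

variable {d k W T n B : ℕ} {Z 𝓗 𝓢 : Type*} (A : SketchedSGD d W T n B Z 𝓗 𝓢)

/-- The step size `η_t = γ / (t + ξ)`; `t : Fin T` stands for update number `t + 1`. -/
noncomputable def stepSize (t : Fin T) : ℝ := A.γ / (((t : ℕ) : ℝ) + 1 + A.ξ)

/-- The weight `q_t = (ξ + t) ^ 2`; `t : Fin T` stands for update number `t + 1`. -/
noncomputable def weight (t : Fin T) : ℝ := (A.ξ + (((t : ℕ) : ℝ) + 1)) ^ 2

/-- The stochastic gradient of the whole minibatch. -/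
noncomputable def meanOracle (t : Fin T) (w : Vec d) (z : Z) : Vec d :=
  (W : ℝ)⁻¹ • ∑ i : Fin W, A.oracle t i w z

/-- The hash functions determined by the seeds of one update. -/
def hash (s : Fin (2 * n + 1) → 𝓗 × 𝓢) : SketchHash d n B where
  bucket r := A.bucketFamily (s r).1
  sign r := A.signFamily (s r).2

/-- Error correction on worker `i`. -/
noncomputable def corrected (t : Fin T) (z : Z) (x : SGDState d W) (i : Fin W) : Vec d :=
  A.stepSize t • A.oracle t i x.w z + x.err i

/-- The server's average of the sketches of all workers. -/
noncomputable def aggregate (t : Fin T) (s : Fin (2 * n + 1) → 𝓗 × 𝓢) (z : Z)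
    (x : SGDState d W) : Matrix (Fin (2 * n + 1)) (Fin B) ℝ :=
  (W : ℝ)⁻¹ • ∑ i : Fin W, (A.hash s).sketch (A.corrected t z x i)

/-- The `k` coordinates that HeavyMix selects from the aggregated sketch. -/
noncomputable def top (t : Fin T) (s : Fin (2 * n + 1) → 𝓗 × 𝓢) (ω : Z × Selection d k)
    (x : SGDState d W) : Finset (Fin d) :=
  (ω.2 ((A.hash s).heavy k (A.aggregate t s ω.1 x))).1

/-- The output of HeavyMix: on the selected coordinates, the exact values, averaged over the
workers; zero elsewhere. -/
noncomputable def sparseUpdate (t : Fin T) (s : Fin (2 * n + 1) → 𝓗 × 𝓢)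
    (ω : Z × Selection d k) (x : SGDState d W) : Vec d :=
  WithLp.toLp 2 fun j =>
    if j ∈ A.top t s ω x then (W : ℝ)⁻¹ * ∑ i : Fin W, A.corrected t ω.1 x i j else 0

/-- One update of the model and of the accumulated errors. -/
noncomputable def step (t : Fin T) (s : Fin (2 * n + 1) → 𝓗 × 𝓢) (ω : Z × Selection d k)
    (x : SGDState d W) : SGDState d W where
  w := x.w - A.sparseUpdate t s ω x
  err i := A.corrected t ω.1 x i - A.sparseUpdate t s ω x

/-- The state after `m` updates (constant from `m = T` on). -/
noncomputable def state (s : HashSeeds T n 𝓗 𝓢) (ω : Samples d k T Z) : ℕ → SGDState d W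
  | 0 => ⟨A.init, fun _ => 0⟩
  | m + 1 =>
    if hm : m < T then A.step ⟨m, hm⟩ (s ⟨m, hm⟩) (ω ⟨m, hm⟩) (state s ω m)
    else state s ω m

/-- The iterate at which the gradients of update `t` are computed. -/
noncomputable def iterate (s : HashSeeds T n 𝓗 𝓢) (ω : Samples d k T Z) (t : Fin T) : Vec d :=
  (A.state s ω t).w

/-- The output: the weighted average of the `T` iterates. -/
noncomputable def output (s : HashSeeds T n 𝓗 𝓢) (ω : Samples d k T Z) : Vec d :=
  (∑ t : Fin T, A.weight t)⁻¹ • ∑ t : Fin T, A.weight t • A.iterate s ω t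

/-- All that is exchanged between the server and worker `i` in update `t`, from state `x`: the
sketch of the worker, the server's request for the selected coordinates, the
exact values of these, and the sparse model update. -/
noncomputable def workerMessages (t : Fin T) (s : Fin (2 * n + 1) → 𝓗 × 𝓢)
    (ω : Z × Selection d k) (x : SGDState d W) (i : Fin W) : List (Message d) :=
  ((List.finRange (2 * n + 1)).flatMap fun r => (List.finRange B).map fun b =>
      Message.real ((A.hash s).sketch (A.corrected t ω.1 x i) r b)) ++
  (A.top t s ω x).toList.map Message.index ++
  (A.top t s ω x).toList.map (fun j => Message.real (A.corrected t ω.1 x i j)) ++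
  (A.top t s ω x).toList.flatMap
    fun j => [Message.index j, Message.real (A.sparseUpdate t s ω x j)]

/-- The total number of bits exchanged in update `t`, if real numbers are encoded with `p` bits. -/
noncomputable def communication (p : ℕ) (s : HashSeeds T n 𝓗 𝓢) (ω : Samples d k T Z)
    (t : Fin T) : ℕ :=
  ∑ i : Fin W,
    ((A.workerMessages t (s t) (ω t) (A.state s ω t) i).map (Message.bits p)).sum

end SketchedSGD

/-- At the point `w`, the stochastic gradient `g w z`, with `z` of law `ν`, is unbiased, its second
moment is at most `G ^ 2`, and its variance is at most `σ ^ 2`. -/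
structure GoodGradientAt {d : ℕ} {Z : Type*} [MeasurableSpace Z] (ν : Measure Z)
    (f : Vec d → ℝ) (g : Vec d → Z → Vec d) (σ G : ℝ) (w : Vec d) : Prop where
  unbiased : Integrable (g w) ν ∧ ∫ z, g w z ∂ν = gradient f w
  second_moment : ∫⁻ z, ‖g w z‖ₑ ^ 2 ∂ν ≤ ENNReal.ofReal (G ^ 2)
  variance : ∫⁻ z, ‖g w z - gradient f w‖ₑ ^ 2 ∂ν ≤ ENNReal.ofReal (σ ^ 2)

/-- Half the number of rows of the sketch, up to rounding: `⌈c log (d T / δ)⌉`. -/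
noncomputable def sketchRows (c : ℝ) (d T : ℕ) (δ : ℝ) : ℕ :=
  ⌈c * Real.log ((d : ℝ) * T / δ)⌉₊

/-! ### Second moments of sign characters -/

/-! The convergence proof is error feedback with a randomised compressor. Write e for the
worker-averaged error and a for the averaged corrected gradient. The virtual iterate w - e performs
plain SGD with gradients taken at w (`w_sub_meanErr_step`), so it suffices that E‖e‖² is of order
(d/k)²η²G². Strong convexity and smoothness absorb such an error (`progress_le`), multiplication by
a cubic weight makes the recursion telescope (`sum_weighted_gap_le`), and Jensen passes to the
averaged output.

The error stays small because HeavyMix contracts: on average over the selection it leaves at most a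
fraction 1 - k/(16d) of ‖a‖². Only false positives can spoil this; missed heavy coordinates are
harmless. If every reported coordinate carries ‖a‖²/(8k) (`SketchHash.Faithful`), then either at
least k/2 selected coordinates are reported ones, or at least half of the selection is random and
catches each unreported coordinate with probability at least k/(2d) (`sum_comparable_ge`). For a
fixed vector, faithfulness fails with probability at most (d+1)/4^(n+1): Chebyshev in each row, then
an exponential moment bound for the medians (`card_not_faithful_le`).

The delicate point is the order of quantifiers. The hash functions are fixed before the expectation
over the samples is taken, and a may take infinitely many values, so no union bound over a is
available. Instead `failureMoment` measures the part of E‖a‖² on which the sketch is unfaithful. The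
state before update t does not depend on the seeds of update t, so averaging over these seeds bounds
the failure moment by δ/(2T) of E‖a‖². Markov's inequality and a union bound over t show that
outside a δ-fraction of the seeds at most half of the moment is lost in each update
(`card_failingSeeds_le`). For such seeds the contraction persists in mean with factor 1 - k/(32d).

If T ≤ d/k, the almost sure bound G²/(2μ) on every gap is already below the second term of the rate.
The cubic term of the rate is not needed at all. The communication is a deterministic count, since
exactly k coordinates are always selected. -/

theorem Finset.prod_mul_prod_eq_prod_symmDiff {ι : Type*} [DecidableEq ι] {χ : ι → ℝ}
    (hχ : ∀ i, χ i * χ i = 1) (I J : Finset ι) :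
    (∏ i ∈ I, χ i) * ∏ i ∈ J, χ i = ∏ i ∈ symmDiff I J, χ i := by
  have hIJ : Disjoint (I \ J) (J \ I) := by
    rw [Finset.disjoint_left]; intro a; simp only [Finset.mem_sdiff]; tauto
  have h1 := Finset.prod_inter_mul_prod_sdiff I J χ
  have h2 := Finset.prod_inter_mul_prod_sdiff J I χ
  have h3 : (∏ i ∈ I ∩ J, χ i) * ∏ i ∈ I ∩ J, χ i = 1 := by
    rw [← Finset.prod_mul_distrib]; exact Finset.prod_eq_one fun i _ => hχ i
  rw [symmDiff_def, Finset.sup_eq_union, Finset.prod_union hIJ, ← h1, ← h2, Finset.inter_comm J I]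
  linear_combination (∏ i ∈ I \ J, χ i) * (∏ i ∈ J \ I, χ i) * h3

theorem cast_sign_mul_self (u : ℤˣ) : ((u : ℤ) : ℝ) * ((u : ℤ) : ℝ) = 1 := by
  rw [← Int.cast_mul, ← Units.val_mul, Int.units_mul_self]; simp

/-- The restriction of a random sign function to `I` is uniform on all sign patterns, so the sum
factors over `I`, and each factor is 1 + (-1). -/
theorem KWiseIndependent.sum_prod_sign_eq_zero {S ι : Type*} [Fintype S] {n : ℕ}
    {h : S → ι → ℤˣ} (hh : KWiseIndependent n h) {I : Finset ι} (hI : I.Nonempty)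
    (hn : I.card ≤ n) : ∑ s, ∏ i ∈ I, ((h s i : ℤ) : ℝ) = 0 := by
  classical
  have key : ∀ v : I → ℤˣ,
      ((Finset.univ.filter fun s => (fun i : I => h s i) = v).card : ℝ) * 2 ^ I.card
        = Fintype.card S := by
    intro v
    -- The value 1 off `I` is arbitrary: independence only constrains points of `I`.
    have := hh I hn (fun i => if hi : i ∈ I then v ⟨i, hi⟩ else 1)
    rw [← this, Nat.card_eq_fintype_card, Fintype.card_subtype]
    push_cast
    congr 3
    · ext s
      simp only [Finset.mem_filter, Finset.mem_univ, true_and, funext_iff, Subtype.forall]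
      exact forall₂_congr fun i hi => by simp [hi]
  have h2 : (∑ s, ∏ i ∈ I, ((h s i : ℤ) : ℝ)) * 2 ^ I.card = 0 := by
    rw [← Finset.sum_fiberwise Finset.univ (fun s => fun i : I => h s i), Finset.sum_mul]
    have : ∀ v : I → ℤˣ,
        (∑ s with (fun i : I => h s i) = v, ∏ i ∈ I, ((h s i : ℤ) : ℝ)) * 2 ^ I.card
          = Fintype.card S * ∏ i : I, ((v i : ℤ) : ℝ) := by
      intro v
      rw [← key v, Finset.sum_congr rfl (g := fun _ => ∏ i : I, ((v i : ℤ) : ℝ))]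
      · simp; ring
      · intro s hs
        simp only [Finset.mem_filter, Finset.mem_univ, true_and] at hs
        rw [← Finset.prod_coe_sort]
        exact Finset.prod_congr rfl fun i _ => by rw [← hs]
    simp_rw [this]
    rw [← Finset.mul_sum]
    have h3 := Finset.prod_univ_sum (fun _ : I => (Finset.univ : Finset ℤˣ))
      (fun _ u => ((u : ℤ) : ℝ))
    rw [Fintype.piFinset_univ] at h3
    rw [← h3]
    obtain ⟨i, hi⟩ := hI
    rw [Finset.prod_eq_zero (Finset.mem_univ (⟨i, hi⟩ : I)), mul_zero]
    have : (Finset.univ : Finset ℤˣ) = {1, -1} := rfl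
    rw [this, Finset.sum_pair (by decide)]
    simp
  exact (mul_eq_zero.mp h2).resolve_right (by positivity)

/-- Parseval for sign characters. Distinct sets of size at most 2 have a nonempty symmetric
difference of size at most 4, which is why 4-wise independence makes their characters orthogonal. -/
theorem KWiseIndependent.sum_sq_sum_prod_sign {S ι P : Type*} [Fintype S] {h : S → ι → ℤˣ}
    (hh : KWiseIndependent 4 h) {Q : Finset P} {I : P → Finset ι} (hI : Set.InjOn I Q)
    (hcard : ∀ p ∈ Q, (I p).card ≤ 2) (c : P → ℝ) :
    ∑ s, (∑ p ∈ Q, c p * ∏ i ∈ I p, ((h s i : ℤ) : ℝ)) ^ 2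
      = Fintype.card S * ∑ p ∈ Q, c p ^ 2 := by
  classical
  have hmul : ∀ s p q, (∏ i ∈ I p, ((h s i : ℤ) : ℝ)) * ∏ i ∈ I q, ((h s i : ℤ) : ℝ)
      = ∏ i ∈ symmDiff (I p) (I q), ((h s i : ℤ) : ℝ) := fun s p q =>
    Finset.prod_mul_prod_eq_prod_symmDiff (fun i => cast_sign_mul_self (h s i)) _ _
  have hortho : ∀ p ∈ Q, ∀ q ∈ Q, ∑ s, ∏ i ∈ symmDiff (I p) (I q), ((h s i : ℤ) : ℝ)
      = if p = q then (Fintype.card S : ℝ) else 0 := by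
    intro p hp q hq
    split_ifs with hpq
    · simp [hpq]
    · refine hh.sum_prod_sign_eq_zero ?_ ?_
      · rw [Finset.nonempty_iff_ne_empty]
        intro he
        exact hpq (hI hp hq (symmDiff_eq_bot.mp he))
      · have h1 : symmDiff (I p) (I q) ⊆ I p ∪ I q := symmDiff_le_sup
        have h2 := Finset.card_le_card h1
        have h3 := Finset.card_union_le (I p) (I q)
        have h4 := hcard p hp
        have h5 := hcard q hq
        omega
  calc ∑ s, (∑ p ∈ Q, c p * ∏ i ∈ I p, ((h s i : ℤ) : ℝ)) ^ 2
      = ∑ s, ∑ p ∈ Q, ∑ q ∈ Q,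
          c p * c q * ∏ i ∈ symmDiff (I p) (I q), ((h s i : ℤ) : ℝ) := by
        refine Finset.sum_congr rfl fun s _ => ?_
        rw [sq, Finset.sum_mul_sum]
        refine Finset.sum_congr rfl fun p _ => Finset.sum_congr rfl fun q _ => ?_
        rw [← hmul]; ring
    _ = ∑ p ∈ Q, ∑ q ∈ Q, c p * c q *
          ∑ s, ∏ i ∈ symmDiff (I p) (I q), ((h s i : ℤ) : ℝ) := by
        rw [Finset.sum_comm]
        refine Finset.sum_congr rfl fun p _ => ?_
        rw [Finset.sum_comm]
        exact Finset.sum_congr rfl fun q _ => by rw [Finset.mul_sum]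
    _ = ∑ p ∈ Q, Fintype.card S * c p ^ 2 := by
        refine Finset.sum_congr rfl fun p hp => ?_
        rw [Finset.sum_congr rfl fun q hq => by rw [hortho p hp q hq]]
        simp [hp]; ring
    _ = _ := by rw [Finset.mul_sum]

/-- Two distinct points collide with probability `1 / B` under pairwise independence. -/
theorem KWiseIndependent.sum_collision {S ι : Type*} [Fintype S] {B : ℕ} (hB : 0 < B)
    {h : S → ι → Fin B} (hh : KWiseIndependent 2 h) {i j : ι} (hij : i ≠ j) :
    (∑ s, if h s i = h s j then (1 : ℝ) else 0) = Fintype.card S / B := by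
  classical
  have key : ∀ b : Fin B, ((Finset.univ.filter fun s => h s i = b ∧ h s j = b).card : ℝ) * B ^ 2
        = Fintype.card S := by
    intro b
    have := hh {i, j} (Finset.card_le_two) (fun _ => b)
    rw [← this, Nat.card_eq_fintype_card, Fintype.card_subtype, Finset.card_pair hij]
    simp
  have h1 : (∑ s, if h s i = h s j then (1 : ℝ) else 0)
      = ∑ b : Fin B, ((Finset.univ.filter fun s => h s i = b ∧ h s j = b).card : ℝ) := by
    simp_rw [Finset.card_filter, Nat.cast_sum]
    rw [Finset.sum_comm]
    refine Finset.sum_congr rfl fun s _ => ?_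
    rw [Finset.sum_eq_single (h s i)]
    · simp [eq_comm]
    · intro b _ hb
      simp [hb.symm]
    · simp
  have hB' : (B : ℝ) ≠ 0 := by positivity
  have h2 : ∀ b : Fin B, ((Finset.univ.filter fun s => h s i = b ∧ h s j = b).card : ℝ)
      = Fintype.card S / B ^ 2 := fun b => by rw [← key b]; field_simp
  rw [h1, Finset.sum_congr rfl fun b _ => h2 b]
  simp
  field_simp

/-! ### One row of a Count Sketch -/

/-- One row of a Count Sketch. -/
noncomputable def rowSketch {d B : ℕ} (bk : Fin d → Fin B) (sg : Fin d → ℤˣ) (x : Vec d)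
    (b : Fin B) : ℝ :=
  ∑ i : Fin d, if bk i = b then ((sg i : ℤ) : ℝ) * x i else 0

theorem Finset.sum_sum_eq_diag_add_two_mul_lt {ι : Type*} [Fintype ι] [LinearOrder ι]
    (f : ι → ι → ℝ) (hf : ∀ i j, f i j = f j i) :
    ∑ i, ∑ j, f i j = ∑ i, f i i + ∑ p : ι × ι with p.1 < p.2, 2 * f p.1 p.2 := by
  have h1 : ∀ i j, f i j = (if i = j then f i j else 0) + (if i < j then f i j else 0)
      + if j < i then f i j else 0 := by
    intro i j
    rcases lt_trichotomy i j with h | h | h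
    · simp [h, h.ne, h.not_gt]
    · simp [h]
    · simp [h, h.ne', h.not_gt]
  have h2 : ∑ i, ∑ j, (if j < i then f i j else 0) = ∑ i, ∑ j, if i < j then f i j else 0 := by
    rw [Finset.sum_comm]
    exact Finset.sum_congr rfl fun i _ => Finset.sum_congr rfl fun j _ => by rw [hf j i]
  have h3 : ∑ i, ∑ j, (if i < j then f i j else 0)
      = ∑ p : ι × ι with p.1 < p.2, f p.1 p.2 := by
    rw [Finset.sum_filter, ← Finset.univ_product_univ, Finset.sum_product]
  rw [Finset.sum_congr rfl fun i _ => Finset.sum_congr rfl fun j _ => h1 i j]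
  simp only [Finset.sum_add_distrib, h2, h3, ← Finset.mul_sum]
  simp
  ring

section Row

variable {d B : ℕ}

theorem sign_mul_rowSketch_sub (bk : Fin d → Fin B) (sg : Fin d → ℤˣ) (x : Vec d) (i : Fin d) :
    ((sg i : ℤ) : ℝ) * rowSketch bk sg x (bk i) - x i
      = ∑ j ∈ Finset.univ.erase i,
          (if bk i = bk j then x j else 0) * ∏ l ∈ {i, j}, ((sg l : ℤ) : ℝ) := by
  unfold rowSketch
  rw [← Finset.add_sum_erase _ _ (Finset.mem_univ i), if_pos rfl, mul_add, ← mul_assoc,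
    cast_sign_mul_self, one_mul, add_sub_cancel_left, Finset.mul_sum]
  refine Finset.sum_congr rfl fun j hj => ?_
  rw [Finset.prod_pair (Finset.ne_of_mem_erase hj).symm]
  by_cases h : bk i = bk j
  · simp [h]; ring
  · simp [h, Ne.symm h]

/-- The squares of the signs are 1, so the diagonal is exactly the squared norm. Pairs are ordered
by `<` so that distinct indices give distinct characters, as Parseval requires. -/
theorem sum_sq_rowSketch_sub (bk : Fin d → Fin B) (sg : Fin d → ℤˣ) (x : Vec d) :
    ∑ b, rowSketch bk sg x b ^ 2 - ‖x‖ ^ 2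
      = ∑ p : Fin d × Fin d with p.1 < p.2,
          2 * (if bk p.1 = bk p.2 then x p.1 * x p.2 else 0)
            * ∏ l ∈ {p.1, p.2}, ((sg l : ℤ) : ℝ) := by
  have h1 : ∑ b, rowSketch bk sg x b ^ 2
      = ∑ i, ∑ j, if bk i = bk j then ((sg i : ℤ) : ℝ) * x i * (((sg j : ℤ) : ℝ) * x j) else 0 := by
    simp_rw [rowSketch, sq, Finset.sum_mul_sum]
    rw [Finset.sum_comm]
    refine Finset.sum_congr rfl fun i _ => ?_
    rw [Finset.sum_comm]
    refine Finset.sum_congr rfl fun j _ => ?_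
    rw [Finset.sum_eq_single (bk i)]
    · by_cases h : bk i = bk j
      · simp [h]
      · simp [h, Ne.symm h]
    · intro b _ hb
      simp [hb.symm]
    · simp
  rw [h1, Finset.sum_sum_eq_diag_add_two_mul_lt, EuclideanSpace.real_norm_sq_eq]
  · rw [add_sub_assoc, add_sub_left_comm, ← Finset.sum_sub_distrib]
    rw [Finset.sum_eq_zero (s := Finset.univ), add_zero]
    · refine Finset.sum_congr rfl fun p hp => ?_
      rw [Finset.prod_pair (Finset.mem_filter.mp hp).2.ne]
      split_ifs <;> ring
    · intro i _
      have := cast_sign_mul_self (sg i)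
      rw [if_pos rfl]
      linear_combination (x i) ^ 2 * this
  · intro i j
    by_cases h : bk i = bk j
    · simp [h]; ring
    · simp [h, Ne.symm h]

variable {𝓗 𝓢 : Type*} [Fintype 𝓗] [Fintype 𝓢] {bf : 𝓗 → Fin d → Fin B} {sf : 𝓢 → Fin d → ℤˣ}

/-- For fixed buckets, Parseval turns the sign average into the squared mass that collides with `i`;
each other coordinate collides with probability 1/B. -/
theorem sum_sq_coord_error_le (hB : 0 < B) (hb : KWiseIndependent 2 bf)
    (hs : KWiseIndependent 4 sf) (x : Vec d) (i : Fin d) :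
    ∑ p : 𝓗 × 𝓢, (((sf p.2 i : ℤ) : ℝ) * rowSketch (bf p.1) (sf p.2) x (bf p.1 i) - x i) ^ 2
      ≤ Fintype.card (𝓗 × 𝓢) * (‖x‖ ^ 2 / B) := by
  rw [← Finset.univ_product_univ, Finset.sum_product]
  have h1 : ∀ a : 𝓗, ∑ b : 𝓢,
      (((sf b i : ℤ) : ℝ) * rowSketch (bf a) (sf b) x (bf a i) - x i) ^ 2
      = Fintype.card 𝓢 * ∑ j ∈ Finset.univ.erase i, (if bf a i = bf a j then x j else 0) ^ 2 := by
    intro a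
    simp_rw [sign_mul_rowSketch_sub]
    refine hs.sum_sq_sum_prod_sign (I := fun j => {i, j}) ?_ (fun j _ => Finset.card_le_two) _
    intro j hj j' hj' he
    have : j ∈ ({i, j'} : Finset (Fin d)) := by
      simp only at he
      rw [← he]; simp
    simp only [Finset.mem_insert, Finset.mem_singleton] at this
    exact this.resolve_left (Finset.ne_of_mem_erase hj)
  rw [Finset.sum_congr rfl fun a _ => h1 a, ← Finset.mul_sum, Finset.sum_comm]
  have h2 : ∀ j ∈ Finset.univ.erase i, ∑ a, (if bf a i = bf a j then x j else 0) ^ 2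
      = Fintype.card 𝓗 / B * x j ^ 2 := by
    intro j hj
    rw [← hb.sum_collision hB (Finset.ne_of_mem_erase hj).symm, Finset.sum_mul]
    refine Finset.sum_congr rfl fun a _ => ?_
    split_ifs <;> simp
  rw [Finset.sum_congr rfl h2, ← Finset.mul_sum, Fintype.card_prod, EuclideanSpace.real_norm_sq_eq]
  have h3 : ∑ j ∈ Finset.univ.erase i, x j ^ 2 ≤ ∑ j, x j ^ 2 :=
    Finset.sum_le_sum_of_subset_of_nonneg (Finset.erase_subset _ _) fun _ _ _ => sq_nonneg _
  push_cast
  calc (Fintype.card 𝓢 : ℝ) * (Fintype.card 𝓗 / B * ∑ j ∈ Finset.univ.erase i, x j ^ 2)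
      ≤ Fintype.card 𝓢 * (Fintype.card 𝓗 / B * ∑ j, x j ^ 2) := by gcongr
    _ = _ := by ring

/-- The same two averages as for a coordinate, now over pairs of coordinates in a common bucket. -/
theorem sum_sq_norm_error_le (hB : 0 < B) (hb : KWiseIndependent 2 bf)
    (hs : KWiseIndependent 4 sf) (x : Vec d) :
    ∑ p : 𝓗 × 𝓢, (∑ b, rowSketch (bf p.1) (sf p.2) x b ^ 2 - ‖x‖ ^ 2) ^ 2
      ≤ Fintype.card (𝓗 × 𝓢) * (2 * (‖x‖ ^ 2) ^ 2 / B) := by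
  rw [← Finset.univ_product_univ, Finset.sum_product]
  have h1 : ∀ a : 𝓗, ∑ b : 𝓢, (∑ c, rowSketch (bf a) (sf b) x c ^ 2 - ‖x‖ ^ 2) ^ 2
      = Fintype.card 𝓢 * ∑ p : Fin d × Fin d with p.1 < p.2,
          (2 * (if bf a p.1 = bf a p.2 then x p.1 * x p.2 else 0)) ^ 2 := by
    intro a
    simp_rw [sum_sq_rowSketch_sub]
    refine hs.sum_sq_sum_prod_sign (I := fun p : Fin d × Fin d => {p.1, p.2}) ?_
      (fun j _ => Finset.card_le_two) _
    rintro ⟨i, j⟩ hij ⟨k, l⟩ hkl he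
    simp only [Finset.coe_filter, Finset.mem_univ, true_and, Set.mem_ofPred_eq] at hij hkl he
    have e1 : i ∈ ({k, l} : Finset (Fin d)) := by rw [← he]; simp
    have e2 : j ∈ ({k, l} : Finset (Fin d)) := by rw [← he]; simp
    simp only [Finset.mem_insert, Finset.mem_singleton] at e1 e2
    rcases e1 with rfl | rfl <;> rcases e2 with rfl | rfl
    · exact absurd hij (lt_irrefl _)
    · rfl
    · exact absurd hij hkl.not_gt
    · exact absurd hij (lt_irrefl _)
  rw [Finset.sum_congr rfl fun a _ => h1 a, ← Finset.mul_sum, Finset.sum_comm]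
  have h2 : ∀ p ∈ Finset.univ.filter (fun p : Fin d × Fin d => p.1 < p.2),
      ∑ a, (2 * (if bf a p.1 = bf a p.2 then x p.1 * x p.2 else 0)) ^ 2
      = 2 * (Fintype.card 𝓗 / B) * (2 * (x p.1 ^ 2 * x p.2 ^ 2)) := by
    intro p hp
    rw [← hb.sum_collision hB (Finset.mem_filter.mp hp).2.ne, Finset.mul_sum, Finset.sum_mul]
    refine Finset.sum_congr rfl fun a _ => ?_
    split_ifs <;> ring
  rw [Finset.sum_congr rfl h2, ← Finset.mul_sum, Fintype.card_prod]
  have h3 : ∑ p : Fin d × Fin d with p.1 < p.2, 2 * (x p.1 ^ 2 * x p.2 ^ 2)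
      ≤ (‖x‖ ^ 2) ^ 2 := by
    have := Finset.sum_sum_eq_diag_add_two_mul_lt (fun i j => x i ^ 2 * x j ^ 2)
      (fun i j => mul_comm _ _)
    rw [EuclideanSpace.real_norm_sq_eq, sq (∑ i, x i ^ 2), Finset.sum_mul_sum, this]
    exact le_add_of_nonneg_left (Finset.sum_nonneg fun i _ => by positivity)
  push_cast
  calc (Fintype.card 𝓢 : ℝ) * (2 * (Fintype.card 𝓗 / B) *
        ∑ p : Fin d × Fin d with p.1 < p.2, 2 * (x p.1 ^ 2 * x p.2 ^ 2))
      ≤ Fintype.card 𝓢 * (2 * (Fintype.card 𝓗 / B) * (‖x‖ ^ 2) ^ 2) := by gcongr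
    _ = _ := by ring

end Row

/-! ### Medians -/

section Median

variable {n : ℕ} (v : Fin (2 * n + 1) → ℝ)

theorem card_le_median : n + 1 ≤ (Finset.univ.filter fun r => v r ≤ median v).card := by
  have h1 : ((Finset.Iic (⟨n, by omega⟩ : Fin (2 * n + 1))).map
      (Tuple.sort v).toEmbedding).card = n + 1 := by simp
  rw [← h1]
  refine Finset.card_le_card fun r hr => ?_
  simp only [Finset.mem_map, Finset.mem_Iic, Equiv.coe_toEmbedding] at hr
  obtain ⟨i, hi, rfl⟩ := hr
  exact Finset.mem_filter.mpr ⟨Finset.mem_univ _, Tuple.monotone_sort v hi⟩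

theorem card_median_le : n + 1 ≤ (Finset.univ.filter fun r => median v ≤ v r).card := by
  have h1 : ((Finset.Ici (⟨n, by omega⟩ : Fin (2 * n + 1))).map
      (Tuple.sort v).toEmbedding).card = n + 1 := by
    rw [Finset.card_map, Fin.card_Ici]; simp; omega
  rw [← h1]
  refine Finset.card_le_card fun r hr => ?_
  simp only [Finset.mem_map, Finset.mem_Ici, Equiv.coe_toEmbedding] at hr
  obtain ⟨i, hi, rfl⟩ := hr
  exact Finset.mem_filter.mpr ⟨Finset.mem_univ _, Tuple.monotone_sort v hi⟩

theorem median_le_iff (c : ℝ) :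
    median v ≤ c ↔ n + 1 ≤ (Finset.univ.filter fun r => v r ≤ c).card := by
  constructor
  · intro h
    exact (card_le_median v).trans (Finset.card_le_card fun r hr => by
      simp only [Finset.mem_filter, Finset.mem_univ, true_and] at hr ⊢
      exact hr.trans h)
  · intro h
    by_contra! hc
    have h1 := card_median_le v
    have h2 : Disjoint (Finset.univ.filter fun r => v r ≤ c)
        (Finset.univ.filter fun r => median v ≤ v r) := by
      rw [Finset.disjoint_filter]
      intro r _ hr
      exact not_le.mpr (hr.trans_lt hc)
    have h3 := Finset.card_union_of_disjoint h2
    have h4 := Finset.card_le_univ ((Finset.univ.filter fun r => v r ≤ c) ∪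
      (Finset.univ.filter fun r => median v ≤ v r))
    simp only [Fintype.card_fin] at h4
    omega

/-- On whichever side of `c` the median lies, the `n + 1` values at least as far out on that side
are also bad. So a wrong median forces a majority of wrong rows. -/
theorem card_of_lt_sq_median_sub {c θ : ℝ} (h : θ < (median v - c) ^ 2) :
    n + 1 ≤ (Finset.univ.filter fun r => θ < (v r - c) ^ 2).card := by
  rcases le_total c (median v) with hc | hc
  · refine (card_median_le v).trans (Finset.card_le_card fun r hr => ?_)
    simp only [Finset.mem_filter, Finset.mem_univ, true_and] at hr ⊢
    refine h.trans_le (pow_le_pow_left₀ (by linarith) (by linarith) 2)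
  · refine (card_le_median v).trans (Finset.card_le_card fun r hr => ?_)
    simp only [Finset.mem_filter, Finset.mem_univ, true_and] at hr ⊢
    refine h.trans_le ?_
    nlinarith

theorem measurable_median {Ω : Type*} [MeasurableSpace Ω] {v : Ω → Fin (2 * n + 1) → ℝ}
    (hv : ∀ r, Measurable fun ω => v ω r) : Measurable fun ω => median (v ω) := by
  refine measurable_of_Iic fun c => ?_
  have : (fun ω => median (v ω)) ⁻¹' Set.Iic c
      = (fun ω => (Finset.univ.filter fun r => v ω r ≤ c).card) ⁻¹' Set.Ici (n + 1) := by
    ext ω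
    simp [median_le_iff]
  rw [this]
  refine measurableSet_preimage ?_ measurableSet_Ici
  simp_rw [Finset.card_filter]
  exact Finset.measurable_fun_sum _ fun r _ =>
    Measurable.ite (measurableSet_le (hv r) measurable_const) measurable_const measurable_const

end Median

/-! ### Amplification by independent repetition -/

/-- Exponential Markov with weight 16 per bad row. The mean weight of one row is at most 1 + 15/16 ≤
2, so the failure probability is at most 2^(2n+1) / 16^(n+1) ≤ 4^-(n+1). -/
theorem card_majority_bad_le {Ω : Type*} [Fintype Ω] (bad : Ω → Prop) [DecidablePred bad]
    (hbad : 16 * (Finset.univ.filter bad).card ≤ Fintype.card Ω) (n : ℕ) :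
    4 ^ (n + 1) * (Finset.univ.filter fun s : Fin (2 * n + 1) → Ω =>
      n + 1 ≤ (Finset.univ.filter fun r => bad (s r)).card).card
      ≤ Fintype.card (Fin (2 * n + 1) → Ω) := by
  have h1 : ∑ s : Fin (2 * n + 1) → Ω, 16 ^ (Finset.univ.filter fun r => bad (s r)).card
      = (∑ ω : Ω, if bad ω then 16 else 1) ^ (2 * n + 1) := by
    have := Finset.prod_univ_sum (fun _ : Fin (2 * n + 1) => (Finset.univ : Finset Ω))
      (fun _ ω => if bad ω then 16 else 1)
    rw [Fintype.piFinset_univ, Finset.prod_const, Finset.card_univ, Fintype.card_fin] at this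
    rw [this]
    refine Finset.sum_congr rfl fun s _ => ?_
    rw [Finset.prod_ite]
    simp
  have h2 : (∑ ω : Ω, if bad ω then 16 else 1) ≤ 2 * Fintype.card Ω := by
    have h3 : ∀ ω, (if bad ω then 16 else 1) = 1 + 15 * if bad ω then 1 else 0 := by
      intro ω; split_ifs <;> rfl
    rw [Finset.sum_congr rfl fun ω _ => h3 ω, Finset.sum_add_distrib, ← Finset.mul_sum,
      ← Finset.card_filter]
    have h5 : (Finset.univ.filter fun ω => bad ω).card = (Finset.univ.filter bad).card := rfl
    simp only [Finset.sum_const, Finset.card_univ, smul_eq_mul, mul_one]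
    omega
  have h4 : 16 ^ (n + 1) * (Finset.univ.filter fun s : Fin (2 * n + 1) → Ω =>
      n + 1 ≤ (Finset.univ.filter fun r => bad (s r)).card).card
      ≤ (2 * Fintype.card Ω) ^ (2 * n + 1) := by
    refine le_trans ?_ ((h1.le).trans (Nat.pow_le_pow_left h2 _))
    rw [Finset.card_filter, Finset.mul_sum]
    refine Finset.sum_le_sum fun s _ => ?_
    split_ifs with h
    · simpa using Nat.pow_le_pow_right (by norm_num) h
    · simp
  have h5 : (2 * Fintype.card Ω) ^ (2 * n + 1)
      ≤ 4 ^ (n + 1) * Fintype.card (Fin (2 * n + 1) → Ω) := by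
    rw [Fintype.card_fun, Fintype.card_fin, mul_pow]
    refine Nat.mul_le_mul_right _ ?_
    rw [show 4 = 2 ^ 2 from rfl, ← pow_mul]
    exact Nat.pow_le_pow_right (by norm_num) (by omega)
  have h6 : (16 : ℕ) ^ (n + 1) = 4 ^ (n + 1) * 4 ^ (n + 1) := by rw [← mul_pow]; norm_num
  rw [h6, mul_assoc] at h4
  exact Nat.le_of_mul_le_mul_left (h4.trans h5) (by positivity)

/-! ### Faithful sketches -/

/-- Every coordinate that the sketch of `x` reports as heavy carries at least a `1 / (8 k)`
fraction of the squared norm of `x`. -/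
def SketchHash.Faithful {d n B : ℕ} (h : SketchHash d n B) (k : ℕ) (x : Vec d) : Prop :=
  ∀ j ∈ h.heavy k (h.sketch x), ‖x‖ ^ 2 ≤ 8 * k * x j ^ 2

theorem card_lt_mul_le_sum {Ω : Type*} [Fintype Ω] (F : Ω → ℝ) (hF : ∀ ω, 0 ≤ F ω) (θ : ℝ) :
    ((Finset.univ.filter fun ω => θ < F ω).card : ℝ) * θ ≤ ∑ ω, F ω := by
  rw [← nsmul_eq_mul]
  refine (Finset.card_nsmul_le_sum _ F θ fun ω hω => (Finset.mem_filter.mp hω).2.le).trans ?_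
  exact Finset.sum_le_sum_of_subset_of_nonneg (Finset.subset_univ _) fun ω _ _ => hF ω

namespace SketchedSGD

variable {d k W T n : ℕ} {Z 𝓗 𝓢 : Type*} [Fintype 𝓗] [Fintype 𝓢]
  (A : SketchedSGD d W T n (256 * k) Z 𝓗 𝓢)

-- A union bound over the d coordinate medians and the norm median: when all of these are accurate,
-- no light coordinate is reported. The zero vector is treated apart because the Chebyshev
-- thresholds vanish there.
open Classical in
theorem card_not_faithful_le (hk : 0 < k) (hb : KWiseIndependent 2 A.bucketFamily)
    (hs : KWiseIndependent 4 A.signFamily) (x : Vec d) :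
    4 ^ (n + 1) * (Finset.univ.filter fun s : Fin (2 * n + 1) → 𝓗 × 𝓢 =>
      ¬ (A.hash s).Faithful k x).card ≤ (d + 1) * Fintype.card (Fin (2 * n + 1) → 𝓗 × 𝓢) := by
  rcases eq_or_ne x 0 with rfl | hx
  · rw [Finset.filter_false_of_mem]
    · simp
    · intro s _ h
      exact h fun j _ => by simp
  have hN : 0 < ‖x‖ ^ 2 := by positivity
  have hk' : (0 : ℝ) < k := by exact_mod_cast hk
  have hB : 0 < 256 * k := by positivity
  set N : ℝ := ‖x‖ ^ 2 with hNdef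
  -- With 256k columns the mean squared errors are at most N/(256k) for a coordinate and 2N²/(256k)
  -- for the norm, so these thresholds are exceeded with probability at most 1/16 and 1/(32k).
  let cbad (i : Fin d) (p : 𝓗 × 𝓢) : Prop := N / (16 * k) <
    (((A.signFamily p.2 i : ℤ) : ℝ) *
      rowSketch (A.bucketFamily p.1) (A.signFamily p.2) x (A.bucketFamily p.1 i) - x i) ^ 2
  let nbad (p : 𝓗 × 𝓢) : Prop := (N / 2) ^ 2 <
    (∑ b, rowSketch (A.bucketFamily p.1) (A.signFamily p.2) x b ^ 2 - N) ^ 2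
  have hc : ∀ i, 16 * (Finset.univ.filter (cbad i)).card ≤ Fintype.card (𝓗 × 𝓢) := by
    intro i
    have h1 := (card_lt_mul_le_sum _ (fun p => sq_nonneg _) (N / (16 * k))).trans
      (sum_sq_coord_error_le hB hb hs x i)
    have h2 : ((Finset.univ.filter (cbad i)).card : ℝ) * (N / (16 * k))
        ≤ (Fintype.card (𝓗 × 𝓢) : ℝ) / 16 * (N / (16 * k)) := by
      refine h1.trans_eq ?_
      push_cast
      field_simp
      ring
    have h3 := le_of_mul_le_mul_right h2 (by positivity)
    have h4 : (16 : ℝ) * (Finset.univ.filter (cbad i)).card ≤ Fintype.card (𝓗 × 𝓢) := by linarith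
    exact_mod_cast h4
  have hn : 16 * (Finset.univ.filter nbad).card ≤ Fintype.card (𝓗 × 𝓢) := by
    have h1 := (card_lt_mul_le_sum _ (fun p => sq_nonneg _) ((N / 2) ^ 2)).trans
      (sum_sq_norm_error_le hB hb hs x)
    have h2 : ((Finset.univ.filter nbad).card : ℝ) * (N / 2) ^ 2
        ≤ (Fintype.card (𝓗 × 𝓢) : ℝ) / 32 / k * (N / 2) ^ 2 := by
      refine h1.trans_eq ?_
      push_cast
      field_simp
      ring
    have h3 := le_of_mul_le_mul_right h2 (by positivity)
    have h5 : (Fintype.card (𝓗 × 𝓢) : ℝ) / 32 / k ≤ Fintype.card (𝓗 × 𝓢) / 32 :=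
      div_le_self (by positivity) (by exact_mod_cast hk)
    have h6 : (0 : ℝ) ≤ (Finset.univ.filter nbad).card := by positivity
    have h4 : (16 : ℝ) * (Finset.univ.filter nbad).card ≤ Fintype.card (𝓗 × 𝓢) := by linarith
    exact_mod_cast h4
  let maj (bad : 𝓗 × 𝓢 → Prop) : Finset (Fin (2 * n + 1) → 𝓗 × 𝓢) :=
    Finset.univ.filter fun s => n + 1 ≤ (Finset.univ.filter fun r => bad (s r)).card
  have hsub : (Finset.univ.filter fun s : Fin (2 * n + 1) → 𝓗 × 𝓢 => ¬ (A.hash s).Faithful k x)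
      ⊆ maj nbad ∪ Finset.univ.biUnion fun i => maj (cbad i) := by
    intro s hs
    by_contra hmem
    simp only [Finset.mem_union, Finset.mem_biUnion, Finset.mem_univ, true_and, not_or,
      not_exists, maj, Finset.mem_filter] at hmem hs
    refine hs fun j hj => ?_
    obtain ⟨h1, h2⟩ := hmem
    have h3 : (SketchHash.queryNormSq ((A.hash s).sketch x) - N) ^ 2 ≤ (N / 2) ^ 2 := by
      by_contra! h
      exact h1 (card_of_lt_sq_median_sub _ h)
    have h4 : ((A.hash s).queryCoord ((A.hash s).sketch x) j - x j) ^ 2 ≤ N / (16 * k) := by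
      by_contra! h
      exact h2 j (card_of_lt_sq_median_sub _ h)
    simp only [SketchHash.heavy, Finset.mem_filter, Finset.mem_univ, true_and] at hj
    set m := SketchHash.queryNormSq ((A.hash s).sketch x)
    set q := (A.hash s).queryCoord ((A.hash s).sketch x) j
    have h5 : N / 2 ≤ m := by
      have := abs_le_of_sq_le_sq h3 (by positivity)
      linarith [(abs_le.mp this).1]
    rw [div_le_iff₀ hk'] at hj
    rw [le_div_iff₀ (by positivity)] at h4
    -- Being reported gives N/(2k) ≤ q², and the error contributes at most N/(8k); what remains is
    -- x_j² ≥ 3N/(16k), more than the required N/(8k).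
    have h6 : q ^ 2 ≤ 2 * x j ^ 2 + 2 * (q - x j) ^ 2 := by nlinarith [sq_nonneg (q - 2 * x j)]
    have h7 := mul_le_mul_of_nonneg_right h6 hk'.le
    nlinarith
  have hcard : (Finset.univ.filter fun s : Fin (2 * n + 1) → 𝓗 × 𝓢 =>
      ¬ (A.hash s).Faithful k x).card ≤ (maj nbad).card + ∑ i, (maj (cbad i)).card :=
    (Finset.card_le_card hsub).trans ((Finset.card_union_le _ _).trans
      (Nat.add_le_add_left Finset.card_biUnion_le _))
  refine (Nat.mul_le_mul_left _ hcard).trans ?_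
  rw [mul_add, Finset.mul_sum, add_mul, one_mul, add_comm]
  refine Nat.add_le_add ?_ (card_majority_bad_le nbad hn n)
  refine (Finset.sum_le_sum fun i _ => card_majority_bad_le (cbad i) (hc i) n).trans ?_
  simp

end SketchedSGD

theorem le_four_pow_sketchRows {d T : ℕ} {δ : ℝ} (hd : 0 < d) (hT : 0 < T) (hδ : 0 < δ) :
    (d : ℝ) * T / δ ≤ 4 ^ sketchRows 1 d T δ := by
  have hpos : (0 : ℝ) < (d : ℝ) * T / δ := by positivity
  have h1 : Real.log ((d : ℝ) * T / δ) ≤ (sketchRows 1 d T δ : ℕ) := by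
    have := Nat.le_ceil (1 * Real.log ((d : ℝ) * T / δ))
    rw [one_mul] at this
    simpa [sketchRows] using this
  calc (d : ℝ) * T / δ = Real.exp (Real.log ((d : ℝ) * T / δ)) := (Real.exp_log hpos).symm
    _ ≤ Real.exp ((sketchRows 1 d T δ : ℕ) : ℝ) := Real.exp_le_exp.mpr h1
    _ = Real.exp 1 ^ sketchRows 1 d T δ := by rw [← Real.exp_nat_mul, mul_one]
    _ ≤ 4 ^ sketchRows 1 d T δ := by
        have : Real.exp 1 < 3 := Real.exp_one_lt_three
        gcongr
        linarith

-- The ratio (d+1)/4^(n+1) is at most 2d/(4dT/δ) = δ/(2T). The spare factor 1/2 pays for the later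
-- Markov inequality at level 1/2.
open Classical in
theorem SketchedSGD.card_not_faithful_le_div {d k W T n : ℕ} {δ : ℝ} {Z 𝓗 𝓢 : Type*}
    [Fintype 𝓗] [Fintype 𝓢] (A : SketchedSGD d W T n (256 * k) Z 𝓗 𝓢)
    (hk : 0 < k) (hd : 0 < d) (hT : 0 < T) (hδ : 0 < δ) (h2 : (d : ℝ) * T / δ ≤ 4 ^ n)
    (hb : KWiseIndependent 2 A.bucketFamily) (hs : KWiseIndependent 4 A.signFamily) (x : Vec d) :
    ((Finset.univ.filter fun s : Fin (2 * n + 1) → 𝓗 × 𝓢 =>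
      ¬ (A.hash s).Faithful k x).card : ℝ)
      ≤ δ / (2 * T) * Fintype.card (Fin (2 * n + 1) → 𝓗 × 𝓢) := by
  have h1 := A.card_not_faithful_le hk hb hs x
  set b := (Finset.univ.filter fun s : Fin (2 * n + 1) → 𝓗 × 𝓢 =>
      ¬ (A.hash s).Faithful k x).card
  set N := Fintype.card (Fin (2 * n + 1) → 𝓗 × 𝓢)
  have h3 : (4 : ℝ) ^ (n + 1) * b ≤ (d + 1) * N := by exact_mod_cast h1
  have hd' : (1 : ℝ) ≤ d := by exact_mod_cast hd
  have hT' : (0 : ℝ) < T := by exact_mod_cast hT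
  have h4 : 4 * ((d : ℝ) * T / δ) * b ≤ 2 * d * N := by
    calc 4 * ((d : ℝ) * T / δ) * b ≤ 4 * 4 ^ n * b := by gcongr
      _ = 4 ^ (n + 1) * b := by ring
      _ ≤ (d + 1) * N := h3
      _ ≤ 2 * d * N := by gcongr; linarith
  have h5 : 4 * ((d : ℝ) * T / δ) * b = 2 * d * (2 * T / δ * b) := by ring
  rw [h5] at h4
  have h6 := le_of_mul_le_mul_left (by linarith : 2 * (d : ℝ) * (2 * T / δ * b) ≤ 2 * d * N)
    (by positivity)
  rw [div_mul_eq_mul_div, le_div_iff₀ (by positivity)]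
  rw [div_mul_eq_mul_div, div_le_iff₀ hδ] at h6
  linarith

/-! ### Resampling one component -/

/-- Replacing the component `i` of a family by `y`, and returning the old component, is an
involution. -/
def Equiv.exchangeComponent {ι : Type*} [DecidableEq ι] {κ : ι → Type*} (i : ι) :
    (∀ j, κ j) × κ i ≃ (∀ j, κ j) × κ i where
  toFun p := (Function.update p.1 i p.2, p.1 i)
  invFun p := (Function.update p.1 i p.2, p.1 i)
  left_inv p := by simp
  right_inv p := by simp

/-- The finite form of integrating out one independent component. It serves both the hash seeds of
one update and the value of a selection rule at one set. -/
theorem Fintype.sum_sum_update {ι M : Type*} [DecidableEq ι] [Fintype ι] {κ : ι → Type*}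
    [∀ j, Fintype (κ j)] [AddCommMonoid M] (i : ι) (F : (∀ j, κ j) → M) :
    ∑ f, ∑ y, F (Function.update f i y) = Fintype.card (κ i) • ∑ f, F f := by
  have h := (Equiv.exchangeComponent i).sum_comp (fun p : (∀ j, κ j) × κ i => F p.1)
  simp only [Equiv.exchangeComponent, Equiv.coe_fn_mk] at h
  rw [← Fintype.sum_prod_type' (f := fun f y => F (Function.update f i y)), h,
    Fintype.sum_prod_type]
  simp [Finset.smul_sum]

/-! ### The random selection -/

section Selection

variable {d k : ℕ}

theorem exists_comparable (hkd : k ≤ d) (H : Finset (Fin d)) :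
    ∃ S : Finset (Fin d), S.card = k ∧ (S ⊆ H ∨ H ⊆ S) := by
  rcases le_total k H.card with h | h
  · obtain ⟨S, hS, hc⟩ := Finset.exists_subset_card_eq h
    exact ⟨S, hc, Or.inl hS⟩
  · obtain ⟨S, hS, hc⟩ := Finset.exists_superset_card_eq h (by simpa using hkd)
    exact ⟨S, hc, Or.inr hS⟩

theorem Selection.nonempty (hkd : k ≤ d) : Nonempty (Selection d k) :=
  ⟨fun H => ⟨_, (exists_comparable hkd H).choose_spec⟩⟩

/-- Each element outside `H` lies in a `(k - |H|) / (d - |H|)` fraction of the `k`-element sets that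
contain `H`. -/
theorem card_supersets_mem_mul (H : Finset (Fin d)) {j : Fin d}
    (hj : j ∉ H) :
    (Finset.univ.filter fun S : Finset (Fin d) => (S.card = k ∧ H ⊆ S) ∧ j ∈ S).card
        * (d - H.card)
      = (Finset.univ.filter fun S : Finset (Fin d) => S.card = k ∧ H ⊆ S).card
        * (k - H.card) := by
  -- Transposing i and j fixes `H` and permutes the admissible sets, so all elements outside `H` are
  -- covered equally often; double counting then gives the common value.
  have hle : ∀ i ∉ H, ∀ j ∉ H,
      (Finset.univ.filter fun S : Finset (Fin d) => (S.card = k ∧ H ⊆ S) ∧ i ∈ S).card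
      ≤ (Finset.univ.filter fun S : Finset (Fin d) => (S.card = k ∧ H ⊆ S) ∧ j ∈ S).card := by
    intro i hi j hj
    refine Finset.card_le_card_of_injOn (fun S => S.map (Equiv.swap i j).toEmbedding) ?_
      ((Finset.map_injective _).injOn)
    intro S hS
    simp only [Finset.coe_filter, Finset.mem_univ, true_and, Set.mem_ofPred_eq] at hS ⊢
    obtain ⟨⟨hc, hHS⟩, hiS⟩ := hS
    refine ⟨⟨by simpa using hc, fun a ha => ?_⟩, ?_⟩
    · rw [Finset.mem_map_equiv, Equiv.symm_swap, Equiv.swap_apply_of_ne_of_ne]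
      · exact hHS ha
      · rintro rfl; exact hi ha
      · rintro rfl; exact hj ha
    · rw [Finset.mem_map_equiv]; simpa using hiS
  have heq : ∀ i ∈ Hᶜ,
      (Finset.univ.filter fun S : Finset (Fin d) => (S.card = k ∧ H ⊆ S) ∧ i ∈ S).card
      = (Finset.univ.filter fun S : Finset (Fin d) => (S.card = k ∧ H ⊆ S) ∧ j ∈ S).card :=
    fun i hi => le_antisymm (hle i (Finset.mem_compl.mp hi) j hj)
      (hle j hj i (Finset.mem_compl.mp hi))
  have h1 : ∑ i ∈ Hᶜ,
      (Finset.univ.filter fun S : Finset (Fin d) => (S.card = k ∧ H ⊆ S) ∧ i ∈ S).card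
      = (Finset.univ.filter fun S : Finset (Fin d) => S.card = k ∧ H ⊆ S).card
        * (k - H.card) := by
    have h2 : ∀ i,
        (Finset.univ.filter fun S : Finset (Fin d) => (S.card = k ∧ H ⊆ S) ∧ i ∈ S).card
        = ∑ S : Finset (Fin d) with S.card = k ∧ H ⊆ S, if i ∈ S then 1 else 0 := by
      intro i
      rw [← Finset.filter_filter, Finset.card_filter]
    rw [Finset.sum_congr rfl fun i _ => h2 i, Finset.sum_comm, ← smul_eq_mul, ← Finset.sum_const]
    refine Finset.sum_congr rfl fun S hS => ?_
    obtain ⟨hc, hHS⟩ := (Finset.mem_filter.mp hS).2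
    rw [← Finset.card_filter, ← hc, ← Finset.card_sdiff_of_subset hHS]
    congr 1
    ext a
    simp [and_comm]
  rw [← h1, Finset.sum_congr rfl heq, Finset.sum_const, Finset.card_compl, Fintype.card_fin,
    smul_eq_mul, mul_comm]

/-- If |H| ≥ k/2, every admissible set contains at least k/2 elements of `H`, which together carry
‖x‖²/16. Otherwise every admissible set contains `H`, and each coordinate outside `H` is included
with probability (k - |H|)/(d - |H|) ≥ k/(2d). -/
theorem sum_comparable_ge (hk : 0 < k) (hkd : k ≤ d) (H : Finset (Fin d)) (x : Vec d)
    (hH : ∀ j ∈ H, ‖x‖ ^ 2 ≤ 8 * k * x j ^ 2) :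
    (Fintype.card {S : Finset (Fin d) // S.card = k ∧ (S ⊆ H ∨ H ⊆ S)} : ℝ)
        * ((k : ℝ) / (16 * d) * ‖x‖ ^ 2)
      ≤ ∑ S : {S : Finset (Fin d) // S.card = k ∧ (S ⊆ H ∨ H ⊆ S)}, ∑ j ∈ S.1, x j ^ 2 := by
  have hk' : (0 : ℝ) < k := by exact_mod_cast hk
  have hkd' : (k : ℝ) ≤ d := by exact_mod_cast hkd
  have hd' : (0 : ℝ) < d := hk'.trans_le hkd'
  by_cases hm : k ≤ 2 * H.card
  · rw [← nsmul_eq_mul, ← Finset.card_univ]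
    refine Finset.card_nsmul_le_sum _ _ _ fun S _ => ?_
    obtain ⟨S, hc, hS⟩ := S
    have h1 : k ≤ 2 * (S ∩ H).card := by
      rcases hS with h | h
      · rw [Finset.inter_eq_left.mpr h]; omega
      · rwa [Finset.inter_eq_right.mpr h]
    have h1' : (k : ℝ) ≤ 2 * (S ∩ H).card := by exact_mod_cast h1
    have h2 : ((S ∩ H).card : ℝ) * (‖x‖ ^ 2 / (8 * k)) ≤ ∑ j ∈ S ∩ H, x j ^ 2 := by
      rw [← nsmul_eq_mul]
      refine Finset.card_nsmul_le_sum _ _ _ fun j hj => ?_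
      rw [div_le_iff₀ (by positivity)]
      linarith [hH j (Finset.mem_inter.mp hj).2]
    have h3 : ∑ j ∈ S ∩ H, x j ^ 2 ≤ ∑ j ∈ S, x j ^ 2 :=
      Finset.sum_le_sum_of_subset_of_nonneg Finset.inter_subset_left fun _ _ _ => sq_nonneg _
    refine le_trans ?_ (h2.trans h3)
    calc (k : ℝ) / (16 * d) * ‖x‖ ^ 2 ≤ k / (16 * k) * ‖x‖ ^ 2 := by gcongr
      _ = (k / 2) * (‖x‖ ^ 2 / (8 * k)) := by field_simp; ring
      _ ≤ (S ∩ H).card * (‖x‖ ^ 2 / (8 * k)) := by gcongr; linarith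
  · push Not at hm
    have hP : ∀ S : Finset (Fin d), (S.card = k ∧ (S ⊆ H ∨ H ⊆ S)) ↔ (S.card = k ∧ H ⊆ S) := by
      intro S
      refine and_congr_right fun hc => or_iff_right fun h => ?_
      have := Finset.card_le_card h
      omega
    set C := Finset.univ.filter fun S : Finset (Fin d) => S.card = k ∧ H ⊆ S with hC
    have hcard : Fintype.card {S : Finset (Fin d) // S.card = k ∧ (S ⊆ H ∨ H ⊆ S)} = C.card := by
      rw [Fintype.card_subtype, hC]
      congr 1
      ext S
      simp [hP]
    have hsum : ∑ S : {S : Finset (Fin d) // S.card = k ∧ (S ⊆ H ∨ H ⊆ S)}, ∑ j ∈ S.1, x j ^ 2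
        = ∑ S ∈ C, ∑ j ∈ S, x j ^ 2 := by
      rw [← Finset.sum_subtype C (fun S => by rw [hP, hC]; simp) (fun S => ∑ j ∈ S, x j ^ 2)]
    rw [hcard, hsum]
    have hswap : ∑ S ∈ C, ∑ j ∈ S, x j ^ 2
        = ∑ j, ((C.filter fun S => j ∈ S).card : ℝ) * x j ^ 2 := by
      have : ∀ S ∈ C, ∑ j ∈ S, x j ^ 2 = ∑ j, if j ∈ S then x j ^ 2 else 0 := by
        intro S _; simp
      rw [Finset.sum_congr rfl this, Finset.sum_comm]
      refine Finset.sum_congr rfl fun j _ => ?_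
      rw [← Finset.sum_filter, Finset.sum_const, nsmul_eq_mul]
    rw [hswap, EuclideanSpace.real_norm_sq_eq, Finset.mul_sum, Finset.mul_sum]
    refine Finset.sum_le_sum fun j _ => ?_
    rw [← mul_assoc]
    refine mul_le_mul_of_nonneg_right ?_ (sq_nonneg _)
    by_cases hj : j ∈ H
    · rw [Finset.filter_true_of_mem fun S hS => (Finset.mem_filter.mp hS).2.2 hj]
      refine mul_le_of_le_one_right (by positivity) ?_
      rw [div_le_one (by positivity)]
      linarith
    · have h1 := card_supersets_mem_mul (k := k) H hj
      rw [← Finset.filter_filter, ← hC] at h1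
      have hmd : H.card ≤ d := by omega
      have h2 : ((C.filter fun S => j ∈ S).card : ℝ) * ((d : ℝ) - H.card)
          = C.card * ((k : ℝ) - H.card) := by
        rw [← Nat.cast_sub hmd, ← Nat.cast_sub (by omega : H.card ≤ k)]
        exact_mod_cast h1
      have hm' : 2 * (H.card : ℝ) < k := by exact_mod_cast hm
      have h3 : (C.card : ℝ) * (k / 2) ≤ (C.filter fun S => j ∈ S).card * d := by
        calc (C.card : ℝ) * (k / 2) ≤ C.card * ((k : ℝ) - H.card) := by gcongr; linarith
          _ = (C.filter fun S => j ∈ S).card * ((d : ℝ) - H.card) := h2.symm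
          _ ≤ _ := by gcongr; linarith [(Nat.cast_nonneg H.card : (0 : ℝ) ≤ H.card)]
      have h4 : (0 : ℝ) ≤ C.card * k := by positivity
      rw [← mul_div_assoc, div_le_iff₀ (by positivity)]
      linarith

/-- A uniform rule has a uniform value at the single set `H`, so averaging over rules reduces to
averaging over the sets comparable with `H`. -/
theorem Selection.sum_residual_le (hk : 0 < k) (hkd : k ≤ d) (H : Finset (Fin d)) (x : Vec d)
    (hH : ∀ j ∈ H, ‖x‖ ^ 2 ≤ 8 * k * x j ^ 2) :
    ∑ σ : Selection d k, (‖x‖ ^ 2 - ∑ j ∈ (σ H).1, x j ^ 2)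
      ≤ Fintype.card (Selection d k) * ((1 - (k : ℝ) / (16 * d)) * ‖x‖ ^ 2) := by
  have h1 := sum_comparable_ge hk hkd H x hH
  have h2 := Fintype.sum_sum_update (κ := fun H : Finset (Fin d) =>
    {S : Finset (Fin d) // S.card = k ∧ (S ⊆ H ∨ H ⊆ S)}) H
    (fun σ => ∑ j ∈ (σ H).1, x j ^ 2)
  simp only [Function.update_self, Finset.sum_const, nsmul_eq_mul, Finset.card_univ] at h2
  set c := (Fintype.card {S : Finset (Fin d) // S.card = k ∧ (S ⊆ H ∨ H ⊆ S)} : ℝ) with hc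
  have hpos : 0 < c := by
    obtain ⟨S, hS⟩ := exists_comparable hkd H
    have : Nonempty {S : Finset (Fin d) // S.card = k ∧ (S ⊆ H ∨ H ⊆ S)} := ⟨⟨S, hS⟩⟩
    rw [hc]
    exact_mod_cast Fintype.card_pos
  have h3 : (Fintype.card (Selection d k) : ℝ) * (k / (16 * d) * ‖x‖ ^ 2)
      ≤ ∑ σ : Selection d k, ∑ j ∈ (σ H).1, x j ^ 2 := by
    refine le_of_mul_le_mul_left ?_ hpos
    refine le_trans ?_ h2.le
    calc c * ((Fintype.card (Selection d k) : ℝ) * (k / (16 * d) * ‖x‖ ^ 2))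
        = Fintype.card (Selection d k) * (c * (k / (16 * d) * ‖x‖ ^ 2)) := by ring
      _ ≤ _ := mul_le_mul_of_nonneg_left h1 (by positivity)
  rw [Finset.sum_sub_distrib, Finset.sum_const, nsmul_eq_mul, Finset.card_univ]
  linarith

end Selection

/-! ### Smooth and strongly convex functions -/

namespace SmoothStronglyConvex

variable {d : ℕ} {f : Vec d → ℝ} {L μ : ℝ}

/-- Convexity from `y` back to `x` together with the Lipschitz gradient avoids integrating along a
segment, at the price of `L` in place of L/2. -/
theorem le_add_mul_sq (hf : SmoothStronglyConvex f L μ) (hμ : 0 ≤ μ) (x y : Vec d) :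
    f y ≤ f x + inner ℝ (gradient f x) (y - x) + L * ‖y - x‖ ^ 2 := by
  have h1 := hf.strong y x
  have h2 := real_inner_le_norm (gradient f y - gradient f x) (y - x)
  have h3 := mul_le_mul_of_nonneg_right (hf.smooth x y) (norm_nonneg (y - x))
  have h4 : inner ℝ (gradient f y) (x - y) = - inner ℝ (gradient f y) (y - x) := by
    rw [← inner_neg_right, neg_sub]
  rw [inner_sub_left] at h2
  have h5 : 0 ≤ μ / 2 * ‖x - y‖ ^ 2 := by positivity
  nlinarith

variable {wstar : Vec d}

theorem norm_sq_gradient_le (hf : SmoothStronglyConvex f L μ) (hμ : 0 ≤ μ) (hL : 0 < L)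
    (hmin : ∀ w, f wstar ≤ f w) (w : Vec d) :
    ‖gradient f w‖ ^ 2 ≤ 4 * L * (f w - f wstar) := by
  have h1 := hf.le_add_mul_sq hμ w (w - (1 / (2 * L)) • gradient f w)
  have h2 := hmin (w - (1 / (2 * L)) • gradient f w)
  rw [sub_sub_cancel_left, inner_neg_right, inner_smul_right, real_inner_self_eq_norm_sq, norm_neg,
    norm_smul, mul_pow, Real.norm_eq_abs, sq_abs] at h1
  have h3 : L * ((1 / (2 * L)) ^ 2 * ‖gradient f w‖ ^ 2) = ‖gradient f w‖ ^ 2 / (4 * L) := by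
    field_simp; ring
  have h4 : 1 / (2 * L) * ‖gradient f w‖ ^ 2 = 2 * (‖gradient f w‖ ^ 2 / (4 * L)) := by
    field_simp; ring
  rw [h3, h4] at h1
  have h5 : ‖gradient f w‖ ^ 2 / (4 * L) ≤ f w - f wstar := by linarith
  rw [div_le_iff₀ (by positivity)] at h5
  linarith

theorem sub_le_norm_sq_gradient (hf : SmoothStronglyConvex f L μ) (hμ : 0 < μ) (w : Vec d) :
    f w - f wstar ≤ ‖gradient f w‖ ^ 2 / (2 * μ) := by
  have h1 := hf.strong w wstar
  have h2 := abs_real_inner_le_norm (gradient f w) (wstar - w)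
  have h3 := (abs_le.mp h2).1
  rw [le_div_iff₀ (by positivity)]
  nlinarith [sq_nonneg (‖gradient f w‖ - μ * ‖wstar - w‖)]

/-- Strong convexity towards the minimizer bounds the distance by 2‖∇f‖/μ. Applied at the initial
point, it removes the initial distance from the rate. -/
theorem norm_sub_sq_le (hf : SmoothStronglyConvex f L μ) (hμ : 0 < μ)
    (hmin : ∀ w, f wstar ≤ f w) (w : Vec d) :
    ‖w - wstar‖ ^ 2 ≤ 4 * ‖gradient f w‖ ^ 2 / μ ^ 2 := by
  have h1 := hf.strong w wstar
  have h0 := hmin w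
  have h2 := abs_real_inner_le_norm (gradient f w) (wstar - w)
  have h3 := (abs_le.mp h2).1
  rw [norm_sub_rev]
  have h4 : ‖wstar - w‖ * (μ * ‖wstar - w‖) ≤ ‖wstar - w‖ * (2 * ‖gradient f w‖) := by nlinarith
  rw [le_div_iff₀ (by positivity)]
  rcases (norm_nonneg (wstar - w)).eq_or_lt with h | h
  · rw [← h]; simp
  · have h5 := le_of_mul_le_mul_left h4 h
    have h6 : 0 ≤ μ * ‖wstar - w‖ := by positivity
    nlinarith

theorem strong_le_smooth (hf : SmoothStronglyConvex f L μ) (hd : 0 < d) : μ ≤ L := by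
  set x : Vec d := EuclideanSpace.single ⟨0, hd⟩ 1
  have hx : ‖x‖ = 1 := by simp [x]
  have h1 := hf.strong 0 x
  have h2 := hf.strong x 0
  have h3 := hf.smooth 0 x
  have h4 := real_inner_le_norm (gradient f x - gradient f 0) x
  rw [inner_sub_left] at h4
  simp only [sub_zero, zero_sub, inner_neg_right, norm_neg, hx] at h1 h2 h3 h4
  linarith

/-- Jensen's inequality via the tangent plane at the weighted mean, whose linear part averages to
zero. -/
theorem map_weighted_sub_le (hf : SmoothStronglyConvex f L μ) (hμ : 0 ≤ μ) {ι : Type*} [Fintype ι]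
    (q : ι → ℝ) (hq : ∀ i, 0 ≤ q i) (hQ : 0 < ∑ i, q i) (w : ι → Vec d) (c : ℝ) :
    f ((∑ i, q i)⁻¹ • ∑ i, q i • w i) - c ≤ (∑ i, q i)⁻¹ * ∑ i, q i * (f (w i) - c) := by
  set Q := ∑ i, q i
  set m := Q⁻¹ • ∑ i, q i • w i with hm
  have h1 : ∀ i, q i * (f m + inner ℝ (gradient f m) (w i - m)) ≤ q i * f (w i) := by
    intro i
    refine mul_le_mul_of_nonneg_left ?_ (hq i)
    have := hf.strong m (w i)
    have h5 : 0 ≤ μ / 2 * ‖w i - m‖ ^ 2 := by positivity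
    linarith
  have h2 := Finset.sum_le_sum fun i (_ : i ∈ Finset.univ) => h1 i
  have h3 : ∑ i, q i * (f m + inner ℝ (gradient f m) (w i - m)) = Q * f m := by
    have h4 : ∑ i, q i * inner ℝ (gradient f m) (w i - m) = 0 := by
      simp_rw [← inner_smul_right]
      rw [← inner_sum]
      simp_rw [smul_sub]
      rw [Finset.sum_sub_distrib, ← Finset.sum_smul, hm, smul_smul, mul_inv_cancel₀ hQ.ne',
        one_smul, sub_self, inner_zero_right]
    simp_rw [mul_add]
    rw [Finset.sum_add_distrib, h4, ← Finset.sum_mul, add_zero]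
  rw [h3] at h2
  simp_rw [mul_sub]
  rw [Finset.sum_sub_distrib, ← Finset.sum_mul, mul_sub, inv_mul_cancel_left₀ hQ.ne']
  have h6 : f m ≤ Q⁻¹ * ∑ i, q i * f (w i) := by
    rw [inv_mul_eq_div, le_div_iff₀ hQ]; linarith
  linarith

/-- The expected progress of one step of SGD with error feedback. The gradient is evaluated at `w`,
while the step is taken from `w - e`. -/
theorem progress_le (hf : SmoothStronglyConvex f L μ) (hμ : 0 < μ) (hL : 0 < L) (hμL : μ ≤ L)
    (hmin : ∀ w, f wstar ≤ f w) {γ s σ G : ℝ} (hγ : 0 < γ) (hs : 0 < s) {w : Vec d}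
    (hG : ‖gradient f w‖ ≤ G) (e : Vec d) :
    ‖w - e - wstar‖ ^ 2 - 2 * (γ / s) * inner ℝ (w - e - wstar) (gradient f w)
        + (γ / s) ^ 2 * (‖gradient f w‖ ^ 2 + σ ^ 2)
      ≤ (1 - γ / s * μ / 2) * ‖w - e - wstar‖ ^ 2 - γ / s / 2 * (f w - f wstar)
        + 5 * L * (γ / s) * ‖e‖ ^ 2 + (γ / s) ^ 2 * σ ^ 2
        + 8 * L * γ ^ 2 * G ^ 2 / s ^ 2 * (γ / s) := by
  set η := γ / s with hη
  have hη0 : 0 < η := by positivity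
  set g := gradient f w
  set Δ := f w - f wstar with hΔ
  have hg := hf.norm_sq_gradient_le hμ.le hL hmin w
  have h1 := hf.strong w wstar
  have h2 : inner ℝ g (wstar - w) = - inner ℝ (w - wstar) g := by
    rw [real_inner_comm, ← inner_neg_left, neg_sub]
  rw [h2, norm_sub_rev] at h1
  have h3 : inner ℝ (w - e - wstar) g = inner ℝ (w - wstar) g - inner ℝ e g := by
    rw [← inner_sub_left]; congr 1; abel
  -- Evaluating the gradient away from the virtual iterate costs one of the two copies of the gap
  -- supplied by strong convexity; the next step spends half of the other, leaving Δ/2.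
  have h4 : 2 * inner ℝ e g ≤ Δ + 4 * L * ‖e‖ ^ 2 := by
    have h5 := real_inner_le_norm e g
    have h6 : 2 * (‖e‖ * ‖g‖) ≤ ‖g‖ ^ 2 / (4 * L) + 4 * L * ‖e‖ ^ 2 := by
      have h7 : 0 ≤ (‖g‖ - 4 * L * ‖e‖) ^ 2 / (4 * L) := by positivity
      have h8 : (‖g‖ - 4 * L * ‖e‖) ^ 2 / (4 * L)
          = ‖g‖ ^ 2 / (4 * L) + 4 * L * ‖e‖ ^ 2 - 2 * (‖e‖ * ‖g‖) := by field_simp; ring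
      linarith
    have h9 : ‖g‖ ^ 2 / (4 * L) ≤ Δ := by
      rw [div_le_iff₀ (by positivity)]; linarith
    linarith
  have h5 : ‖w - e - wstar‖ ^ 2 / 2 - ‖e‖ ^ 2 ≤ ‖w - wstar‖ ^ 2 := by
    have h6 : ‖w - e - wstar‖ ≤ ‖w - wstar‖ + ‖e‖ := by
      rw [sub_right_comm]; exact norm_sub_le _ _
    have h7 := pow_le_pow_left₀ (norm_nonneg _) h6 2
    nlinarith [sq_nonneg (‖w - wstar‖ - ‖e‖)]
  -- The step size is not assumed small compared with 1/L. If 8Lη ≤ 1 the gap absorbs the term;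
  -- otherwise ηG² is inflated by the factor 8Lη ≥ 1 to a term of the order of the feedback error.
  have h6 : η * ‖g‖ ^ 2 ≤ Δ / 2 + 8 * L * γ ^ 2 * G ^ 2 / s ^ 2 := by
    rcases le_total (8 * L * η) 1 with h | h
    · have h7 : 0 ≤ 8 * L * γ ^ 2 * G ^ 2 / s ^ 2 := by positivity
      have h8 : 0 ≤ Δ := sub_nonneg.mpr (hmin w)
      nlinarith
    · have h7 : 8 * L * γ ^ 2 * G ^ 2 / s ^ 2 = (8 * L * η) * (η * G ^ 2) := by
        rw [hη]; field_simp
      have h8 : 0 ≤ Δ := sub_nonneg.mpr (hmin w)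
      have h9 : ‖g‖ ^ 2 ≤ G ^ 2 := pow_le_pow_left₀ (norm_nonneg _) hG 2
      have h10 : η * ‖g‖ ^ 2 ≤ η * G ^ 2 := by gcongr
      have h11 : η * G ^ 2 ≤ (8 * L * η) * (η * G ^ 2) := le_mul_of_one_le_left (by positivity) h
      linarith
  rw [h3]
  have h7 := mul_le_mul_of_nonneg_left h6 hη0.le
  have h8 := mul_le_mul_of_nonneg_left h4 hη0.le
  have h9 := mul_le_mul_of_nonneg_left h1 hη0.le
  have h10 := mul_le_mul_of_nonneg_left h5 (by positivity : 0 ≤ η * μ)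
  have h11 : η * μ * ‖e‖ ^ 2 ≤ η * L * ‖e‖ ^ 2 := by gcongr
  have h12 : f wstar = f w - Δ := by rw [hΔ]; ring
  rw [h12] at h9
  linarith

end SmoothStronglyConvex

/-! ### Scalar recursions -/

/-- The accumulated error of a `1 / (32 r)`-contraction is of the order of `r` times the current
step size. -/
theorem error_recursion_le {T : ℕ} {E : ℕ → ℝ} {r ξ c X : ℝ} (hr : 1 ≤ r) (hc : 0 < c)
    (hξ : c * r ≤ ξ) (hX : 0 ≤ X) (h0 : E 0 = 0)
    (hE : ∀ t < T, E (t + 1) ≤ (1 - 1 / (64 * r)) * E t + 64 * r * (X / (t + 1 + ξ) ^ 2)) :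
    ∀ t ≤ T, E t ≤ 16384 * (1 + 384 / c) ^ 2 * r ^ 2 * X / (t + 1 + ξ) ^ 2 := by
  have hr0 : 0 < r := by linarith
  have hξ0 : 0 < ξ := lt_of_lt_of_le (by positivity) hξ
  set R := (1 + 384 / c) ^ 2 with hR
  -- The shift by 384r makes the squares grow by a factor of at most 1 + 1/(128r) per step, slower
  -- than the contraction; `c * r ≤ ξ` keeps its cost bounded by `R`. Since 16384 = 64 · 256, the
  -- new term uses 1/(256r) of the decay 1/(64r).
  have key : ∀ t ≤ T, E t ≤ 16384 * R * r ^ 2 * X / (t + 1 + ξ + 384 * r) ^ 2 := by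
    intro t
    induction t with
    | zero => intro _; rw [h0]; positivity
    | succ t ih =>
      intro ht
      have h1 := ih (by omega)
      have h2 := hE t (by omega)
      have ht0 : (0 : ℝ) ≤ t := t.cast_nonneg
      set s := (t : ℝ) + 1 + ξ with hs
      have hs0 : 0 < s := by positivity
      have hs' : ((t + 1 : ℕ) : ℝ) + 1 + ξ + 384 * r = s + 384 * r + 1 := by push_cast; ring
      rw [hs']
      set s' := s + 384 * r with hs'def
      have hs'0 : 0 < s' := by positivity
      have h3 : 1 / s ^ 2 ≤ R / s' ^ 2 := by
        have h4 : s' ≤ (1 + 384 / c) * s := by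
          have h5 : 384 * r = 384 / c * (c * r) := by field_simp
          have h6 : 384 / c * (c * r) ≤ 384 / c * s := by gcongr; linarith
          linarith
        have h5 := pow_le_pow_left₀ hs'0.le h4 2
        rw [mul_pow, ← hR] at h5
        rw [div_le_div_iff₀ (by positivity) (by positivity)]
        linarith
      have h4 : (s' + 1) ^ 2 ≤ (1 + 1 / (128 * r)) * s' ^ 2 := by
        have h5 : 384 * r ≤ s' := by linarith
        have h6 : 1 ≤ s' / (384 * r) := by rw [one_le_div (by positivity)]; exact h5
        have h7 : 2 * s' + 1 ≤ s' / (128 * r) * s' := by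
          have h8 : s' / (128 * r) = 3 * (s' / (384 * r)) := by field_simp; norm_num
          have h9 : s' ≤ s' / (384 * r) * s' := le_mul_of_one_le_left hs'0.le h6
          rw [h8]
          linarith
        have h8 : s' / (128 * r) * s' = 1 / (128 * r) * s' ^ 2 := by ring
        linarith
      have hq0 : 0 ≤ 1 - 1 / (64 * r) := by
        rw [sub_nonneg, div_le_one (by positivity)]; linarith
      have h5 : E (t + 1) ≤ (1 - 1 / (64 * r)) * (16384 * R * r ^ 2 * X / s' ^ 2)
          + 64 * r * X * (R / s' ^ 2) := by
        refine h2.trans (add_le_add (mul_le_mul_of_nonneg_left h1 hq0) ?_)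
        calc 64 * r * (X / s ^ 2) = 64 * r * X * (1 / s ^ 2) := by ring
          _ ≤ _ := by gcongr
      refine h5.trans ?_
      rw [le_div_iff₀ (by positivity)]
      have h6 : (1 - 1 / (64 * r)) * (16384 * R * r ^ 2 * X / s' ^ 2) + 64 * r * X * (R / s' ^ 2)
          = (16384 * R * r ^ 2 * X) * (1 - 3 / (256 * r)) / s' ^ 2 := by field_simp; ring
      rw [h6, div_mul_eq_mul_div, div_le_iff₀ (by positivity), mul_assoc (16384 * R * r ^ 2 * X)]
      refine (mul_le_mul_of_nonneg_left ?_ (by positivity)).trans_eq rfl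
      have hq1 : 0 ≤ 1 - 3 / (256 * r) := by
        rw [sub_nonneg, div_le_one (by positivity)]; linarith
      calc (1 - 3 / (256 * r)) * (s' + 1) ^ 2
          ≤ (1 - 3 / (256 * r)) * ((1 + 1 / (128 * r)) * s' ^ 2) := by gcongr
        _ = (1 - 1 / (256 * r) - 3 / (256 * 128 * r ^ 2)) * s' ^ 2 := by field_simp; ring
        _ ≤ 1 * s' ^ 2 := by
            gcongr
            have : 0 ≤ 1 / (256 * r) := by positivity
            have : 0 ≤ 3 / (256 * 128 * r ^ 2) := by positivity
            linarith
        _ = s' ^ 2 := one_mul _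
  intro t ht
  refine (key t ht).trans ?_
  have ht0 : (0 : ℝ) ≤ t := t.cast_nonneg
  refine div_le_div_of_nonneg_left (by positivity) (by positivity) ?_
  exact pow_le_pow_left₀ (by positivity) (by linarith) 2

/-- With s = t + 1 + ξ, multiplication by s³/γ turns the gap coefficient into s²/2, half the output
weight. The two L-terms then become constants of order r²Lγ²G² per step, and the noise term grows
linearly in s. -/
theorem sum_weighted_gap_le {T : ℕ} {D E e : ℕ → ℝ} {γ μ ξ L σ G K r : ℝ}
    (hγ : 0 < γ) (hγμ : 8 ≤ γ * μ) (hξ : 0 ≤ ξ) (hL : 0 < L) (hr : 1 ≤ r)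
    (hD : ∀ t, 0 ≤ D t)
    (hE : ∀ t < T, E t ≤ K * r ^ 2 * (γ ^ 2 * G ^ 2) / (t + 1 + ξ) ^ 2)
    (hstep : ∀ t < T, D (t + 1) ≤ (1 - γ / (t + 1 + ξ) * μ / 2) * D t
      - γ / (t + 1 + ξ) / 2 * e t + 5 * L * (γ / (t + 1 + ξ)) * E t
      + (γ / (t + 1 + ξ)) ^ 2 * σ ^ 2
      + 8 * L * γ ^ 2 * G ^ 2 / (t + 1 + ξ) ^ 2 * (γ / (t + 1 + ξ))) :
    ∑ t ∈ Finset.range T, (ξ + (t + 1)) ^ 2 * e t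
      ≤ 2 * (ξ ^ 3 / γ * D 0
        + T * (γ * (T + ξ) * σ ^ 2 + (5 * K + 8) * r ^ 2 * L * γ ^ 2 * G ^ 2)) := by
  set P := γ * (T + ξ) * σ ^ 2 + (5 * K + 8) * r ^ 2 * L * γ ^ 2 * G ^ 2
  have key : ∀ t ≤ T, (∑ i ∈ Finset.range t, (ξ + (i + 1)) ^ 2 * e i) / 2
      + (t + ξ) ^ 3 / γ * D t ≤ ξ ^ 3 / γ * D 0 + t * P := by
    intro t
    induction t with
    | zero => intro _; simp
    | succ t ih =>
      intro ht
      have h1 := ih (by omega)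
      have h2 := hstep t (by omega)
      have h3 := hE t (by omega)
      have ht0 : (0 : ℝ) ≤ t := t.cast_nonneg
      have htT : (t : ℝ) + 1 ≤ T := by exact_mod_cast ht
      rw [Finset.sum_range_succ]
      push_cast
      rw [show ξ + ((t : ℝ) + 1) = t + 1 + ξ by ring]
      have hts : (t : ℝ) + ξ = (t + 1 + ξ) - 1 := by ring
      rw [hts] at h1
      set s := (t : ℝ) + 1 + ξ with hs
      have hs1 : 1 ≤ s := by linarith
      have hs0 : 0 < s := by linarith
      have h4 : s ^ 3 / γ * D (t + 1) ≤ s ^ 3 / γ * ((1 - γ / s * μ / 2) * D t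
          - γ / s / 2 * e t + 5 * L * (γ / s) * (K * r ^ 2 * (γ ^ 2 * G ^ 2) / s ^ 2)
          + (γ / s) ^ 2 * σ ^ 2 + 8 * L * γ ^ 2 * G ^ 2 / s ^ 2 * (γ / s)) := by
        refine mul_le_mul_of_nonneg_left (h2.trans ?_) (by positivity)
        gcongr
      have h5 : s ^ 3 / γ * ((1 - γ / s * μ / 2) * D t
          - γ / s / 2 * e t + 5 * L * (γ / s) * (K * r ^ 2 * (γ ^ 2 * G ^ 2) / s ^ 2)
          + (γ / s) ^ 2 * σ ^ 2 + 8 * L * γ ^ 2 * G ^ 2 / s ^ 2 * (γ / s))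
          = (s ^ 3 - γ * μ / 2 * s ^ 2) / γ * D t - s ^ 2 * e t / 2
            + γ * s * σ ^ 2 + (5 * K * r ^ 2 + 8) * L * γ ^ 2 * G ^ 2 := by
        field_simp
        ring
      rw [h5] at h4
      -- Telescoping: γμ ≥ 8 gives s³ - 4s² ≤ (s - 1)³ for s ≥ 1.
      have h6 : (s ^ 3 - γ * μ / 2 * s ^ 2) / γ * D t ≤ (s - 1) ^ 3 / γ * D t := by
        refine mul_le_mul_of_nonneg_right (div_le_div_of_nonneg_right ?_ hγ.le) (hD t)
        nlinarith [sq_nonneg s]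
      have h7 : γ * s * σ ^ 2 + (5 * K * r ^ 2 + 8) * L * γ ^ 2 * G ^ 2 ≤ P := by
        have h8 : γ * s * σ ^ 2 ≤ γ * (T + ξ) * σ ^ 2 := by gcongr; linarith
        have h9 : (5 * K * r ^ 2 + 8) * L * γ ^ 2 * G ^ 2
            ≤ (5 * K * r ^ 2 + 8 * r ^ 2) * L * γ ^ 2 * G ^ 2 := by
          gcongr
          nlinarith
        have h10 : (5 * K * r ^ 2 + 8 * r ^ 2) * L * γ ^ 2 * G ^ 2
            = (5 * K + 8) * r ^ 2 * L * γ ^ 2 * G ^ 2 := by ring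
        linarith
      linarith
  have h1 := key T le_rfl
  have h2 : 0 ≤ (T + ξ) ^ 3 / γ * D T := mul_nonneg (by positivity) (hD T)
  linarith

theorem cube_le_three_mul_sum_sq {ξ : ℝ} (hξ : 0 ≤ ξ) (T : ℕ) :
    (T : ℝ) ^ 3 ≤ 3 * ∑ t ∈ Finset.range T, (ξ + ((t : ℝ) + 1)) ^ 2 := by
  induction T with
  | zero => simp
  | succ T ih =>
    rw [Finset.sum_range_succ]
    push_cast
    have hT : (0 : ℝ) ≤ T := T.cast_nonneg
    nlinarith [mul_nonneg hξ hT]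

/-- The final rate, from the weighted sum of the optimality gaps. -/
theorem rate_le {T : ℕ} {γ μ ξ L σ G K M r D₀ Q Y : ℝ} (hT : 0 < T) (hμ : 0 < μ) (hL : μ ≤ L)
    (hM : 0 ≤ M) (hK : 0 ≤ K) (hr : 0 ≤ r) (hrT : r ≤ T)
    (hγμ : 8 ≤ γ * μ) (hγM : γ * μ ≤ M) (hξ : 0 ≤ ξ) (hξM : ξ ≤ M * r)
    (hD0 : 0 ≤ D₀) (hD : D₀ ≤ 4 * G ^ 2 / μ ^ 2) (hQ : (T : ℝ) ^ 3 ≤ 3 * Q)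
    (hY : Y ≤ 2 * (ξ ^ 3 / γ * D₀
        + T * (γ * (T + ξ) * σ ^ 2 + (5 * K + 8) * r ^ 2 * L * γ ^ 2 * G ^ 2))) :
    Q⁻¹ * Y ≤ 6 * (M ^ 3 / 2 + M * (1 + M) + (5 * K + 8) * M ^ 2)
      * (σ ^ 2 / (μ * T) + r ^ 2 * G ^ 2 * L / (μ ^ 2 * T ^ 2)) := by
  have hT' : (0 : ℝ) < T := by exact_mod_cast hT
  have hγ : 0 < γ := by
    by_contra! h
    nlinarith
  have hγ8 : 8 / μ ≤ γ := by rwa [div_le_iff₀ hμ]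
  have hγM' : γ ≤ M / μ := by rwa [le_div_iff₀ hμ]
  have hL0 : 0 < L := hμ.trans_le hL
  have hQ0 : 0 < Q := by
    have : 0 < (T : ℝ) ^ 3 := by positivity
    linarith
  set U := σ ^ 2 / (μ * T) with hU
  set V := r ^ 2 * G ^ 2 * L / (μ ^ 2 * T ^ 2) with hV
  have hU0 : 0 ≤ U := by positivity
  have hV0 : 0 ≤ V := by positivity
  -- The initial term is of order r³G²/μ; one factor r is traded for T, and L/μ ≥ 1 brings it to the
  -- form of the second term of the rate.
  have h1 : ξ ^ 3 / γ * D₀ ≤ M ^ 3 / 2 * V * T ^ 3 := by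
    calc ξ ^ 3 / γ * D₀ ≤ (M * r) ^ 3 / (8 / μ) * (4 * G ^ 2 / μ ^ 2) := by gcongr
      _ = M ^ 3 / 2 * (r ^ 2 * G ^ 2 / μ) * r := by field_simp; ring
      _ ≤ M ^ 3 / 2 * (r ^ 2 * G ^ 2 / μ * (L / μ)) * T := by
          gcongr
          refine le_mul_of_one_le_right (by positivity) ?_
          rwa [one_le_div hμ]
      _ = M ^ 3 / 2 * V * T ^ 3 := by rw [hV]; field_simp
  have h2 : T * (γ * (T + ξ) * σ ^ 2) ≤ M * (1 + M) * U * T ^ 3 := by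
    have h3 : ξ ≤ M * T := hξM.trans (by gcongr)
    calc T * (γ * (T + ξ) * σ ^ 2) ≤ T * (M / μ * (T + M * T) * σ ^ 2) := by gcongr
      _ = M * (1 + M) * U * T ^ 3 := by rw [hU]; field_simp
  have h3 : T * ((5 * K + 8) * r ^ 2 * L * γ ^ 2 * G ^ 2) ≤ (5 * K + 8) * M ^ 2 * V * T ^ 3 := by
    calc T * ((5 * K + 8) * r ^ 2 * L * γ ^ 2 * G ^ 2)
        ≤ T * ((5 * K + 8) * r ^ 2 * L * (M / μ) ^ 2 * G ^ 2) := by gcongr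
      _ = (5 * K + 8) * M ^ 2 * V * T ^ 3 := by rw [hV]; field_simp
  have h4 : Y ≤ 2 * (M ^ 3 / 2 * V + M * (1 + M) * U + (5 * K + 8) * M ^ 2 * V) * T ^ 3 := by
    rw [mul_add (T : ℝ)] at hY
    linarith
  have h5 : M ^ 3 / 2 * V + M * (1 + M) * U + (5 * K + 8) * M ^ 2 * V
      ≤ (M ^ 3 / 2 + M * (1 + M) + (5 * K + 8) * M ^ 2) * (U + V) := by
    have e1 : 0 ≤ M ^ 3 / 2 * U := by positivity
    have e2 : 0 ≤ M * (1 + M) * V := by positivity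
    have e3 : 0 ≤ (5 * K + 8) * M ^ 2 * U := by positivity
    linarith
  rw [inv_mul_le_iff₀ hQ0]
  set Z := (M ^ 3 / 2 + M * (1 + M) + (5 * K + 8) * M ^ 2) * (U + V) with hZ
  have hZ0 : 0 ≤ Z := by positivity
  calc Y ≤ 2 * (M ^ 3 / 2 * V + M * (1 + M) * U + (5 * K + 8) * M ^ 2 * V) * T ^ 3 := h4
    _ ≤ 2 * Z * (3 * Q) := by gcongr
    _ = _ := by rw [hZ]; ring

/-! ### The averaged process -/

theorem measurable_coord {d : ℕ} (j : Fin d) : Measurable fun x : Vec d => x j :=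
  (PiLp.continuous_apply 2 _ j).measurable

namespace SketchHash

variable {d n B : ℕ} (h : SketchHash d n B)

theorem sketch_smul_sum {W : ℕ} (c : ℝ) (x : Fin W → Vec d) :
    h.sketch (c • ∑ i, x i) = c • ∑ i, h.sketch (x i) := by
  ext r b
  simp only [sketch, Matrix.smul_apply, Matrix.sum_apply, smul_eq_mul]
  rw [Finset.sum_comm, Finset.mul_sum]
  refine Finset.sum_congr rfl fun j _ => ?_
  split_ifs
  · simp [Finset.mul_sum]
    exact Finset.sum_congr rfl fun i _ => by ring
  · simp

theorem measurable_sketch (r : Fin (2 * n + 1)) (b : Fin B) :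
    Measurable fun x : Vec d => h.sketch x r b := by
  refine Finset.measurable_fun_sum _ fun i _ => ?_
  split_ifs
  · exact (measurable_coord i).const_mul _
  · exact measurable_const

theorem measurableSet_mem_heavy (k : ℕ) (j : Fin d) :
    MeasurableSet {x : Vec d | j ∈ h.heavy k (h.sketch x)} := by
  simp only [heavy, Finset.mem_filter, Finset.mem_univ, true_and]
  refine measurableSet_le (Measurable.div_const ?_ _) (Measurable.pow_const ?_ _)
  · exact measurable_median fun r =>
      Finset.measurable_fun_sum _ fun b _ => (h.measurable_sketch r b).pow_const _
  · exact measurable_median fun r => (h.measurable_sketch r _).const_mul _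

theorem measurableSet_heavy_eq (k : ℕ) (H : Finset (Fin d)) :
    MeasurableSet {x : Vec d | h.heavy k (h.sketch x) = H} := by
  have : {x : Vec d | h.heavy k (h.sketch x) = H}
      = ⋂ j, {x : Vec d | j ∈ h.heavy k (h.sketch x) ↔ j ∈ H} := by
    ext x
    simp [Finset.ext_iff]
  rw [this]
  refine MeasurableSet.iInter fun j => ?_
  by_cases hj : j ∈ H
  · simpa [hj] using h.measurableSet_mem_heavy k j
  · simp only [hj, iff_false]
    exact (h.measurableSet_mem_heavy k j).compl

theorem measurableSet_faithful (k : ℕ) : MeasurableSet {x : Vec d | h.Faithful k x} := by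
  have : {x : Vec d | h.Faithful k x}
      = ⋂ j, ({x : Vec d | j ∈ h.heavy k (h.sketch x)}ᶜ
          ∪ {x : Vec d | ‖x‖ ^ 2 ≤ 8 * k * x j ^ 2}) := by
    ext x
    simp [Faithful, imp_iff_not_or]
  rw [this]
  refine MeasurableSet.iInter fun j => (h.measurableSet_mem_heavy k j).compl.union ?_
  exact measurableSet_le (measurable_norm.pow_const _)
    (((measurable_coord j).pow_const _).const_mul _)

end SketchHash

/-- The average over the workers of the accumulated errors. -/
noncomputable def SGDState.meanErr {d W : ℕ} (x : SGDState d W) : Vec d :=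
  (W : ℝ)⁻¹ • ∑ i, x.err i

namespace SketchedSGD

variable {d k W T n B : ℕ} {Z 𝓗 𝓢 : Type*} (A : SketchedSGD d W T n B Z 𝓗 𝓢)

/-- The average over the workers of the error-corrected gradients. -/
noncomputable def meanCorrected (t : Fin T) (z : Z) (x : SGDState d W) : Vec d :=
  A.stepSize t • A.meanOracle t x.w z + x.meanErr

theorem smul_sum_corrected (t : Fin T) (z : Z) (x : SGDState d W) :
    (W : ℝ)⁻¹ • ∑ i, A.corrected t z x i = A.meanCorrected t z x := by
  simp only [corrected, meanCorrected, SGDState.meanErr, meanOracle, Finset.sum_add_distrib,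
    smul_add, ← Finset.smul_sum]
  rw [smul_comm]

/-- By linearity of the sketch, the averages over the workers follow a single-worker error feedback
process. -/
theorem aggregate_eq (t : Fin T) (s : Fin (2 * n + 1) → 𝓗 × 𝓢) (z : Z) (x : SGDState d W) :
    A.aggregate t s z x = (A.hash s).sketch (A.meanCorrected t z x) := by
  rw [aggregate, ← SketchHash.sketch_smul_sum, smul_sum_corrected]

theorem top_eq (t : Fin T) (s : Fin (2 * n + 1) → 𝓗 × 𝓢) (ω : Z × Selection d k)
    (x : SGDState d W) :
    A.top t s ω x
      = (ω.2 ((A.hash s).heavy k ((A.hash s).sketch (A.meanCorrected t ω.1 x)))).1 := by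
  rw [top, aggregate_eq]

theorem sparseUpdate_apply (t : Fin T) (s : Fin (2 * n + 1) → 𝓗 × 𝓢) (ω : Z × Selection d k)
    (x : SGDState d W) (j : Fin d) :
    A.sparseUpdate t s ω x j
      = if j ∈ A.top t s ω x then A.meanCorrected t ω.1 x j else 0 := by
  rw [← smul_sum_corrected]
  simp [sparseUpdate]

theorem meanErr_step (hW : 0 < W) (t : Fin T) (s : Fin (2 * n + 1) → 𝓗 × 𝓢)
    (ω : Z × Selection d k) (x : SGDState d W) :
    (A.step t s ω x).meanErr = A.meanCorrected t ω.1 x - A.sparseUpdate t s ω x := by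
  have hW' : (W : ℝ) ≠ 0 := by positivity
  simp only [SGDState.meanErr, step, Finset.sum_sub_distrib, smul_sub, smul_sum_corrected]
  simp [← Nat.cast_smul_eq_nsmul ℝ, smul_smul, hW']

/-- The sparse update is subtracted from both the model and the mean error, so it cancels:
compression is invisible to the virtual iterate except through the point where the gradient is
taken. -/
theorem w_sub_meanErr_step (hW : 0 < W) (t : Fin T) (s : Fin (2 * n + 1) → 𝓗 × 𝓢)
    (ω : Z × Selection d k) (x : SGDState d W) :
    (A.step t s ω x).w - (A.step t s ω x).meanErr
      = x.w - x.meanErr - A.stepSize t • A.meanOracle t x.w ω.1 := by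
  rw [meanErr_step A hW, meanCorrected]
  simp only [step]
  module

/-- Pythagoras: the update and the remaining error have disjoint supports. -/
theorem norm_sq_meanErr_step (hW : 0 < W) (t : Fin T) (s : Fin (2 * n + 1) → 𝓗 × 𝓢)
    (ω : Z × Selection d k) (x : SGDState d W) :
    ‖(A.step t s ω x).meanErr‖ ^ 2
      = ‖A.meanCorrected t ω.1 x‖ ^ 2
        - ∑ j ∈ A.top t s ω x, A.meanCorrected t ω.1 x j ^ 2 := by
  rw [meanErr_step A hW, EuclideanSpace.real_norm_sq_eq, EuclideanSpace.real_norm_sq_eq,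
    ← Finset.sum_sdiff (Finset.subset_univ (A.top t s ω x)),
    ← Finset.sum_sdiff (Finset.subset_univ (A.top t s ω x)), add_sub_cancel_right]
  rw [Finset.sum_eq_zero (s := A.top t s ω x), add_zero]
  · refine Finset.sum_congr rfl fun j hj => ?_
    simp [sparseUpdate_apply, (Finset.mem_sdiff.mp hj).2]
  · intro j hj
    simp [sparseUpdate_apply, hj]

theorem norm_meanErr_step_le (hW : 0 < W) (t : Fin T) (s : Fin (2 * n + 1) → 𝓗 × 𝓢)
    (ω : Z × Selection d k) (x : SGDState d W) :
    ‖(A.step t s ω x).meanErr‖ ≤ ‖A.meanCorrected t ω.1 x‖ := by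
  refine le_of_sq_le_sq ?_ (norm_nonneg _)
  rw [norm_sq_meanErr_step A hW]
  exact sub_le_self _ (Finset.sum_nonneg fun _ _ => sq_nonneg _)

/-! ### Dependence on the randomness of earlier updates only -/

theorem state_succ (s : HashSeeds T n 𝓗 𝓢) (ω : Samples d k T Z) (t : Fin T) :
    A.state s ω (t + 1) = A.step t (s t) (ω t) (A.state s ω t) := by
  rw [state, dif_pos t.2]

/-- The case `m = t` is included, because the state indexed by `t` precedes the update indexed by
`t`. With resampling this replaces conditioning on the past; the analogue for seeds makes the sketch
independent of the vector it compresses. -/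
theorem state_update_samples (s : HashSeeds T n 𝓗 𝓢) (ω : Samples d k T Z) (t : Fin T)
    (y : Z × Selection d k) {m : ℕ} (hm : m ≤ t) :
    A.state s (Function.update ω t y) m = A.state s ω m := by
  induction m with
  | zero => rfl
  | succ m ih =>
    have hmT : m < T := by omega
    have hne : (⟨m, hmT⟩ : Fin T) ≠ t := Fin.ne_of_val_ne (by simp; omega)
    rw [state, state, dif_pos hmT, dif_pos hmT, ih (by omega), Function.update_of_ne hne]

theorem state_update_seeds (s : HashSeeds T n 𝓗 𝓢) (ω : Samples d k T Z) (t : Fin T)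
    (u : Fin (2 * n + 1) → 𝓗 × 𝓢) {m : ℕ} (hm : m ≤ t) :
    A.state (Function.update s t u) ω m = A.state s ω m := by
  induction m with
  | zero => rfl
  | succ m ih =>
    have hmT : m < T := by omega
    have hne : (⟨m, hmT⟩ : Fin T) ≠ t := Fin.ne_of_val_ne (by simp; omega)
    rw [state, state, dif_pos hmT, dif_pos hmT, ih (by omega), Function.update_of_ne hne]

/-! ### Measurability -/

section Measurability

variable [MeasurableSpace Z]

theorem measurable_meanOracle
    (hA : ∀ t i, Measurable (Function.uncurry (A.oracle t i)))
    {Ω : Type*} [MeasurableSpace Ω] (t : Fin T) {w : Ω → Vec d}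
    {z : Ω → Z} (hw : Measurable w) (hz : Measurable z) :
    Measurable fun ω => A.meanOracle t (w ω) (z ω) := by
  have h : Measurable fun ω => ∑ i : Fin W, A.oracle t i (w ω) (z ω) :=
    Finset.measurable_fun_sum _ fun i _ => (hA t i).comp (hw.prodMk hz)
  exact h.const_smul (W : ℝ)⁻¹

theorem measurable_step
    (hA : ∀ t i, Measurable (Function.uncurry (A.oracle t i)))
    {Ω : Type*} [MeasurableSpace Ω] (t : Fin T)
    (s : Fin (2 * n + 1) → 𝓗 × 𝓢) {y : Ω → Z × Selection d k} {X : Ω → SGDState d W}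
    (hy : Measurable y) (hw : Measurable fun ω => (X ω).w)
    (he : ∀ i, Measurable fun ω => (X ω).err i) :
    (Measurable fun ω => (A.step t s (y ω) (X ω)).w) ∧
      ∀ i, Measurable fun ω => (A.step t s (y ω) (X ω)).err i := by
  have hz : Measurable fun ω => (y ω).1 := measurable_fst.comp hy
  have hσ : Measurable fun ω => (y ω).2 := measurable_snd.comp hy
  have hc : ∀ i, Measurable fun ω => A.corrected t (y ω).1 (X ω) i := by
    intro i
    have h : Measurable fun ω => A.oracle t i (X ω).w (y ω).1 := (hA t i).comp (hw.prodMk hz)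
    exact (h.const_smul (A.stepSize t)).add (he i)
  have hmean : Measurable fun ω => A.meanCorrected t (y ω).1 (X ω) := by
    simp_rw [← smul_sum_corrected]
    have h : Measurable fun ω => ∑ i, A.corrected t (y ω).1 (X ω) i :=
      Finset.measurable_fun_sum _ fun i _ => hc i
    exact h.const_smul (W : ℝ)⁻¹
  have htop : ∀ j, MeasurableSet {ω | j ∈ A.top t s (y ω) (X ω)} := by
    intro j
    -- Splitting over the finitely many values of the heavy set separates the dependence on the
    -- sample from that on the selection rule.
    have : {ω | j ∈ A.top t s (y ω) (X ω)} = ⋃ H : Finset (Fin d),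
        ((fun ω => A.meanCorrected t (y ω).1 (X ω)) ⁻¹'
            {x | (A.hash s).heavy k ((A.hash s).sketch x) = H})
          ∩ ((fun ω => (y ω).2) ⁻¹' {σ | j ∈ (σ H).1}) := by
      ext ω
      simp [top_eq]
    rw [this]
    exact MeasurableSet.iUnion fun H =>
      (hmean ((A.hash s).measurableSet_heavy_eq k H)).inter (hσ trivial)
  have hsp : Measurable fun ω => A.sparseUpdate t s (y ω) (X ω) := by
    have hj : ∀ j, Measurable fun ω => A.sparseUpdate t s (y ω) (X ω) j := by
      intro j
      simp_rw [sparseUpdate_apply]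
      exact Measurable.ite (htop j) ((measurable_coord j).comp hmean) measurable_const
    exact (PiLp.continuous_toLp 2 _).measurable.comp (measurable_pi_lambda _ hj)
  exact ⟨hw.sub hsp, fun i => (hc i).sub hsp⟩

theorem measurable_state
    (hA : ∀ t i, Measurable (Function.uncurry (A.oracle t i)))
    (s : HashSeeds T n 𝓗 𝓢) (m : ℕ) :
    (Measurable fun ω : Samples d k T Z => (A.state s ω m).w) ∧
      ∀ i, Measurable fun ω : Samples d k T Z => (A.state s ω m).err i := by
  induction m with
  | zero => exact ⟨measurable_const, fun _ => measurable_const⟩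
  | succ m ih =>
    by_cases hm : m < T
    · simp_rw [state, dif_pos hm]
      exact A.measurable_step hA _ _ (measurable_pi_apply _) ih.1 ih.2
    · simp_rw [state, dif_neg hm]
      exact ih

theorem measurable_state_w
    (hA : ∀ t i, Measurable (Function.uncurry (A.oracle t i)))
    (s : HashSeeds T n 𝓗 𝓢) (m : ℕ) :
    Measurable fun ω : Samples d k T Z => (A.state s ω m).w :=
  (A.measurable_state hA s m).1

theorem measurable_meanErr_state
    (hA : ∀ t i, Measurable (Function.uncurry (A.oracle t i)))
    (s : HashSeeds T n 𝓗 𝓢) (m : ℕ) :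
    Measurable fun ω : Samples d k T Z => (A.state s ω m).meanErr := by
  have h : Measurable fun ω : Samples d k T Z => ∑ i, (A.state s ω m).err i :=
    Finset.measurable_fun_sum _ fun i _ => (A.measurable_state hA s m).2 i
  exact h.const_smul (W : ℝ)⁻¹

theorem measurable_meanOracle_state
    (hA : ∀ t i, Measurable (Function.uncurry (A.oracle t i)))
    (s : HashSeeds T n 𝓗 𝓢) (t : Fin T) :
    Measurable fun ω : Samples d k T Z => A.meanOracle t (A.state s ω t).w (ω t).1 :=
  A.measurable_meanOracle hA t (A.measurable_state_w hA s t)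
    (measurable_fst.comp (measurable_pi_apply t))

theorem measurable_meanCorrected_state
    (hA : ∀ t i, Measurable (Function.uncurry (A.oracle t i)))
    (s : HashSeeds T n 𝓗 𝓢) (t : Fin T) :
    Measurable fun ω : Samples d k T Z => A.meanCorrected t (ω t).1 (A.state s ω t) :=
  ((A.measurable_meanOracle_state hA s t).const_smul (A.stepSize t)).add
    (A.measurable_meanErr_state hA s t)

end Measurability

end SketchedSGD

/-! ### Resampling one component of a product measure -/

/-- This expresses independence of one component from the others: conditional expectations given the
past become inner integrals over a fresh copy of component `i`. -/
theorem MeasureTheory.measurePreserving_update {ι : Type*} [Fintype ι] [DecidableEq ι]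
    {κ : ι → Type*} [∀ i, MeasurableSpace (κ i)] (m : ∀ i, Measure (κ i))
    [∀ i, IsProbabilityMeasure (m i)] (i : ι) :
    MeasurePreserving (fun p : (∀ j, κ j) × κ i => Function.update p.1 i p.2)
      ((Measure.pi m).prod (m i)) (Measure.pi m) := by
  have hmeas : Measurable (fun p : (∀ j, κ j) × κ i => Function.update p.1 i p.2) :=
    measurable_update'
  refine ⟨hmeas, ?_⟩
  symm
  refine Measure.pi_eq fun S hS => ?_
  rw [Measure.map_apply hmeas (MeasurableSet.univ_pi hS)]
  have : (fun p : (∀ j, κ j) × κ i => Function.update p.1 i p.2) ⁻¹' Set.univ.pi S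
      = (Set.univ.pi (Function.update S i Set.univ)) ×ˢ S i := by
    ext p
    simp only [Set.mem_preimage, Set.mem_pi, Set.mem_univ, true_imp_iff, Set.mem_prod]
    constructor
    · intro h
      refine ⟨fun j => ?_, by simpa using h i⟩
      rcases eq_or_ne j i with rfl | hj
      · simp
      · simpa [hj] using h j
    · rintro ⟨h1, h2⟩ j
      rcases eq_or_ne j i with rfl | hj
      · simpa using h2
      · simpa [hj] using h1 j
  rw [this, Measure.prod_prod, Measure.pi_pi, ← Finset.mul_prod_erase _ _ (Finset.mem_univ i),
    ← Finset.mul_prod_erase _ (fun j => m j (S j)) (Finset.mem_univ i)]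
  simp only [Function.update_self, measure_univ, one_mul]
  rw [mul_comm]
  congr 1
  refine Finset.prod_congr rfl fun j hj => ?_
  rw [Function.update_of_ne (Finset.ne_of_mem_erase hj)]

section Resample

variable {d k T : ℕ} {Z : Type*} [MeasurableSpace Z] {ν : Measure Z} [IsProbabilityMeasure ν]

theorem isProbabilityMeasure_uniformSelection (hkd : k ≤ d) :
    IsProbabilityMeasure (ProbabilityTheory.uniformOn (Set.univ : Set (Selection d k))) := by
  have := Selection.nonempty hkd
  exact ProbabilityTheory.isProbabilityMeasure_uniformOn Set.finite_univ Set.univ_nonempty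

theorem isProbabilityMeasure_samplesLaw (hkd : k ≤ d) :
    IsProbabilityMeasure (samplesLaw d k T ν) := by
  have := isProbabilityMeasure_uniformSelection hkd
  unfold samplesLaw
  infer_instance

theorem measurePreserving_update_samples (hkd : k ≤ d) (t : Fin T) :
    MeasurePreserving (fun p : Samples d k T Z × (Z × Selection d k) => Function.update p.1 t p.2)
      ((samplesLaw d k T ν).prod
        (ν.prod (ProbabilityTheory.uniformOn (Set.univ : Set (Selection d k)))))
      (samplesLaw d k T ν) := by
  have := isProbabilityMeasure_uniformSelection hkd
  exact measurePreserving_update (fun _ : Fin T =>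
    ν.prod (ProbabilityTheory.uniformOn (Set.univ : Set (Selection d k)))) t

theorem lintegral_samplesLaw (hkd : k ≤ d) (t : Fin T) {F : Samples d k T Z → ENNReal}
    (hF : Measurable F) :
    ∫⁻ ω, F ω ∂(samplesLaw d k T ν)
      = ∫⁻ ω, ∫⁻ y, F (Function.update ω t y)
          ∂(ν.prod (ProbabilityTheory.uniformOn (Set.univ : Set (Selection d k))))
          ∂(samplesLaw d k T ν) := by
  have := isProbabilityMeasure_uniformSelection hkd
  have := isProbabilityMeasure_samplesLaw (T := T) (ν := ν) hkd
  have hΦ := measurePreserving_update_samples (ν := ν) hkd t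
  rw [← hΦ.lintegral_comp hF]
  exact lintegral_prod _ (hF.comp hΦ.measurable).aemeasurable

theorem lintegral_uniformSelection (F : Selection d k → ENNReal) :
    ∫⁻ σ, F σ ∂(ProbabilityTheory.uniformOn (Set.univ : Set (Selection d k)))
      = (Measure.count (Set.univ : Set (Selection d k)))⁻¹ * ∑ σ, F σ := by
  rw [ProbabilityTheory.uniformOn, ProbabilityTheory.cond, lintegral_smul_measure,
    Measure.restrict_univ, lintegral_count, tsum_fintype, smul_eq_mul]

/-- The contraction holds only after averaging over the selection rule of one update. Working with
lower integrals makes it unnecessary to know that `F` is integrable. -/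
theorem integral_le_of_sum_selection_le (hkd : k ≤ d) (t : Fin T) {F G : Samples d k T Z → ℝ}
    (hF : Measurable F) (hG : Measurable G) (hF0 : ∀ ω, 0 ≤ F ω) (hG0 : ∀ ω, 0 ≤ G ω)
    (hGi : Integrable G (samplesLaw d k T ν))
    (h : ∀ ω z, ∑ σ, F (Function.update ω t (z, σ)) ≤ ∑ σ, G (Function.update ω t (z, σ))) :
    ∫ ω, F ω ∂(samplesLaw d k T ν) ≤ ∫ ω, G ω ∂(samplesLaw d k T ν) := by
  have := isProbabilityMeasure_uniformSelection hkd
  have := isProbabilityMeasure_samplesLaw (T := T) (ν := ν) hkd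
  rw [integral_eq_lintegral_of_nonneg_ae (.of_forall hF0) hF.aestronglyMeasurable,
    integral_eq_lintegral_of_nonneg_ae (.of_forall hG0) hG.aestronglyMeasurable]
  refine ENNReal.toReal_mono ?_ ?_
  · rw [← ofReal_integral_eq_lintegral_ofReal hGi (.of_forall hG0)]
    exact ENNReal.ofReal_ne_top
  · rw [lintegral_samplesLaw hkd t hF.ennreal_ofReal, lintegral_samplesLaw hkd t hG.ennreal_ofReal]
    refine lintegral_mono fun ω => ?_
    have hm : ∀ {F : Samples d k T Z → ℝ}, Measurable F →
        Measurable fun y : Z × Selection d k => ENNReal.ofReal (F (Function.update ω t y)) :=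
      fun hF => (hF.comp (measurable_update ω)).ennreal_ofReal
    simp only
    rw [lintegral_prod _ (hm hF).aemeasurable, lintegral_prod _ (hm hG).aemeasurable]
    refine lintegral_mono fun z => ?_
    simp only
    rw [lintegral_uniformSelection, lintegral_uniformSelection,
      ← ENNReal.ofReal_sum_of_nonneg fun σ _ => hF0 _,
      ← ENNReal.ofReal_sum_of_nonneg fun σ _ => hG0 _]
    exact mul_le_mul_right (ENNReal.ofReal_le_ofReal (h ω z)) _

end Resample

/-! ### Square-integrable vectors -/

theorem memLp_two_of_lintegral_le {Ω : Type*} [MeasurableSpace Ω] {P : Measure Ω} {d : ℕ}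
    {h : Ω → Vec d} (hm : AEStronglyMeasurable h P) {c : ℝ} (hc : 0 ≤ c)
    (hle : ∫⁻ ω, ‖h ω‖ₑ ^ 2 ∂P ≤ ENNReal.ofReal c) :
    MemLp h 2 P ∧ ∫ ω, ‖h ω‖ ^ 2 ∂P ≤ c := by
  have h1 : ∀ ω, ENNReal.ofReal (‖h ω‖ ^ 2) = ‖h ω‖ₑ ^ 2 := fun ω => by
    rw [ENNReal.ofReal_pow (norm_nonneg _), ofReal_norm]
  have h2 : ∫⁻ ω, ENNReal.ofReal (‖h ω‖ ^ 2) ∂P ≤ ENNReal.ofReal c := by simpa only [h1] using hle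
  have h3 : AEStronglyMeasurable (fun ω => ‖h ω‖ ^ 2) P := hm.norm.pow 2
  constructor
  · rw [memLp_two_iff_integrable_sq_norm hm]
    refine ⟨h3, ?_⟩
    rw [hasFiniteIntegral_iff_ofReal (.of_forall fun ω => sq_nonneg _)]
    exact h2.trans_lt ENNReal.ofReal_lt_top
  · rw [integral_eq_lintegral_of_nonneg_ae (.of_forall fun ω => sq_nonneg _) h3]
    exact ENNReal.toReal_le_of_le_ofReal hc h2

theorem integral_affine_two {Ω : Type*} [MeasurableSpace Ω] {P : Measure Ω}
    [IsProbabilityMeasure P] {F H : Ω → ℝ} (hF : Integrable F P) (hH : Integrable H P)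
    (a b e : ℝ) :
    Integrable (fun ω => a * F ω - b * H ω + e) P ∧
      ∫ ω, (a * F ω - b * H ω + e) ∂P = a * ∫ ω, F ω ∂P - b * ∫ ω, H ω ∂P + e := by
  have i1 : Integrable (fun ω => a * F ω - b * H ω) P := (hF.const_mul a).sub (hH.const_mul b)
  refine ⟨i1.add (integrable_const e), ?_⟩
  rw [integral_add i1 (integrable_const e), integral_sub (hF.const_mul a) (hH.const_mul b),
    integral_const_mul, integral_const_mul, integral_const]
  simp

theorem integral_affine_three {Ω : Type*} [MeasurableSpace Ω] {P : Measure Ω}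
    [IsProbabilityMeasure P] {F H K : Ω → ℝ} (hF : Integrable F P) (hH : Integrable H P)
    (hK : Integrable K P) (a b c e : ℝ) :
    Integrable (fun ω => a * F ω - b * H ω + c * K ω + e) P ∧
      ∫ ω, (a * F ω - b * H ω + c * K ω + e) ∂P
        = a * ∫ ω, F ω ∂P - b * ∫ ω, H ω ∂P + c * ∫ ω, K ω ∂P + e := by
  have i1 : Integrable (fun ω => a * F ω - b * H ω) P := (hF.const_mul a).sub (hH.const_mul b)
  have i2 : Integrable (fun ω => a * F ω - b * H ω + c * K ω) P := i1.add (hK.const_mul c)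
  refine ⟨i2.add (integrable_const e), ?_⟩
  rw [integral_add i2 (integrable_const e), integral_add i1 (hK.const_mul c),
    integral_sub (hF.const_mul a) (hH.const_mul b),
    integral_const_mul, integral_const_mul, integral_const_mul, integral_const]
  simp

theorem norm_add_sq_le_weighted {E : Type*} [SeminormedAddCommGroup E] (x y : E) {c : ℝ}
    (hc : 0 < c) : ‖x + y‖ ^ 2 ≤ (1 + c) * ‖x‖ ^ 2 + (1 + 1 / c) * ‖y‖ ^ 2 := by
  have h1 := pow_le_pow_left₀ (norm_nonneg _) (norm_add_le x y) 2
  have h2 : 0 ≤ (c * ‖x‖ - ‖y‖) ^ 2 / c := by positivity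
  have h3 : (c * ‖x‖ - ‖y‖) ^ 2 / c = c * ‖x‖ ^ 2 + 1 / c * ‖y‖ ^ 2 - 2 * ‖x‖ * ‖y‖ := by
    field_simp; ring
  nlinarith

namespace GoodGradientAt

variable {d : ℕ} {Z : Type*} [MeasurableSpace Z] {ν : Measure Z}
  {f : Vec d → ℝ} {g : Vec d → Z → Vec d} {σ G : ℝ} {w : Vec d}

theorem memLp (h : GoodGradientAt ν f g σ G w) : MemLp (g w) 2 ν :=
  (memLp_two_of_lintegral_le h.unbiased.1.1 (sq_nonneg G) h.second_moment).1

theorem integral_norm_sq_sub_gradient [IsProbabilityMeasure ν] (h : GoodGradientAt ν f g σ G w) :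
    ∫ z, ‖g w z - gradient f w‖ ^ 2 ∂ν = ∫ z, ‖g w z‖ ^ 2 ∂ν - ‖gradient f w‖ ^ 2 := by
  have h1 : Integrable (fun z => ‖g w z‖ ^ 2) ν :=
    (memLp_two_iff_integrable_sq_norm h.unbiased.1.1).mp h.memLp
  have h2 : Integrable (fun z => inner ℝ (gradient f w) (g w z)) ν :=
    h.unbiased.1.const_inner _
  have h3 : ∀ z, ‖g w z - gradient f w‖ ^ 2
      = 1 * ‖g w z‖ ^ 2 - 2 * inner ℝ (gradient f w) (g w z) + ‖gradient f w‖ ^ 2 := by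
    intro z
    rw [norm_sub_sq_real, real_inner_comm, one_mul]
  simp_rw [h3]
  rw [(integral_affine_two h1 h2 1 2 _).2, integral_inner h.unbiased.1, h.unbiased.2,
    real_inner_self_eq_norm_sq]
  ring

/-- The variance E‖g‖² - ‖∇f‖² is nonnegative. -/
theorem norm_gradient_le [IsProbabilityMeasure ν] (h : GoodGradientAt ν f g σ G w)
    (hG : 0 ≤ G) : ‖gradient f w‖ ≤ G := by
  have h1 := (memLp_two_of_lintegral_le h.unbiased.1.1 (sq_nonneg G) h.second_moment).2
  have h2 : 0 ≤ ∫ z, ‖g w z - gradient f w‖ ^ 2 ∂ν := integral_nonneg fun _ => sq_nonneg _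
  rw [h.integral_norm_sq_sub_gradient] at h2
  exact le_of_sq_le_sq (by linarith) hG

theorem integral_norm_sq_le [IsProbabilityMeasure ν] (h : GoodGradientAt ν f g σ G w) :
    ∫ z, ‖g w z‖ ^ 2 ∂ν ≤ ‖gradient f w‖ ^ 2 + σ ^ 2 := by
  have h1 := (memLp_two_of_lintegral_le
    (h.unbiased.1.1.sub (aestronglyMeasurable_const (b := gradient f w)))
    (sq_nonneg σ) h.variance).2
  have h2 := h.integral_norm_sq_sub_gradient
  simp only [Pi.sub_apply] at h1
  linarith

theorem integral_norm_sq_step_le [IsProbabilityMeasure ν] (h : GoodGradientAt ν f g σ G w)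
    (v : Vec d) (η : ℝ) :
    ∫ z, ‖v - η • g w z‖ ^ 2 ∂ν ≤ ‖v‖ ^ 2 - 2 * η * inner ℝ v (gradient f w)
      + η ^ 2 * (‖gradient f w‖ ^ 2 + σ ^ 2) := by
  have h1 : Integrable (fun z => ‖g w z‖ ^ 2) ν :=
    (memLp_two_iff_integrable_sq_norm h.unbiased.1.1).mp h.memLp
  have h2 : Integrable (fun z => inner ℝ v (g w z)) ν := h.unbiased.1.const_inner _
  have h3 : ∀ z, ‖v - η • g w z‖ ^ 2
      = η ^ 2 * ‖g w z‖ ^ 2 - 2 * η * inner ℝ v (g w z) + ‖v‖ ^ 2 := by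
    intro z
    rw [norm_sub_sq_real, inner_smul_right, norm_smul, mul_pow, Real.norm_eq_abs, sq_abs]
    ring
  simp_rw [h3]
  rw [(integral_affine_two h1 h2 _ _ _).2, integral_inner h.unbiased.1, h.unbiased.2]
  have := mul_le_mul_of_nonneg_left h.integral_norm_sq_le (sq_nonneg η)
  linarith

end GoodGradientAt

/-! ### Moments along a run -/

namespace SketchedSGD

section Moments

variable {d k W T n B : ℕ} {Z 𝓗 𝓢 : Type*} [MeasurableSpace Z] {ν : Measure Z}
  [IsProbabilityMeasure ν] {f : Vec d → ℝ} {L μ σ G : ℝ} {wstar : Vec d}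
  (A : SketchedSGD d W T n B Z 𝓗 𝓢) (s : HashSeeds T n 𝓗 𝓢)

/-- Almost surely, the stochastic gradients are good along the run. -/
def GoodRun (k : ℕ) (ν : Measure Z) (f : Vec d → ℝ) (σ G : ℝ) : Prop :=
  ∀ t, ∀ᵐ ω ∂(samplesLaw d k T ν), GoodGradientAt ν f (A.meanOracle t) σ G (A.iterate s ω t)

theorem memLp_meanOracle (hkd : k ≤ d)
    (hA : ∀ t i, Measurable (Function.uncurry (A.oracle t i))) {s : HashSeeds T n 𝓗 𝓢}
    (hgood : A.GoodRun s k ν f σ G) (t : Fin T) :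
    MemLp (fun ω => A.meanOracle t (A.state s ω t).w (ω t).1) 2 (samplesLaw d k T ν) ∧
      ∫ ω, ‖A.meanOracle t (A.state s ω t).w (ω t).1‖ ^ 2 ∂(samplesLaw d k T ν) ≤ G ^ 2 := by
  have := isProbabilityMeasure_uniformSelection hkd
  have := isProbabilityMeasure_samplesLaw (T := T) (ν := ν) hkd
  have hm := A.measurable_meanOracle_state (k := k) hA s t
  refine memLp_two_of_lintegral_le hm.aestronglyMeasurable (sq_nonneg G) ?_
  rw [lintegral_samplesLaw hkd t (hm.enorm.pow_const 2)]
  have hle : ∀ᵐ ω ∂(samplesLaw d k T ν), ∫⁻ y, ‖A.meanOracle t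
      (A.state s (Function.update ω t y) t).w (Function.update ω t y t).1‖ₑ ^ 2
        ∂(ν.prod (ProbabilityTheory.uniformOn (Set.univ : Set (Selection d k))))
      ≤ ENNReal.ofReal (G ^ 2) := by
    filter_upwards [hgood t] with ω hω
    simp only [A.state_update_samples s ω t _ le_rfl, Function.update_self]
    have hz : Measurable fun z => ‖A.meanOracle t (A.state s ω t).w z‖ₑ ^ 2 :=
      (A.measurable_meanOracle hA t measurable_const measurable_id).enorm.pow_const 2
    have hfst : MeasurePreserving Prod.fst (ν.prod (ProbabilityTheory.uniformOn
      (Set.univ : Set (Selection d k)))) ν := measurePreserving_fst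
    rw [hfst.lintegral_comp hz]
    exact hω.second_moment
  refine (lintegral_mono_ae hle).trans ?_
  simp

theorem memLp_meanCorrected_of_meanErr (hkd : k ≤ d)
    (hA : ∀ t i, Measurable (Function.uncurry (A.oracle t i))) {s : HashSeeds T n 𝓗 𝓢}
    (hgood : A.GoodRun s k ν f σ G) (t : Fin T)
    (he : MemLp (fun ω => (A.state s ω t).meanErr) 2 (samplesLaw d k T ν)) :
    MemLp (fun ω => A.meanCorrected t (ω t).1 (A.state s ω t)) 2 (samplesLaw d k T ν) :=
  ((A.memLp_meanOracle hkd hA hgood t).1.const_smul (A.stepSize t)).add he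

theorem memLp_meanErr (hW : 0 < W) (hkd : k ≤ d)
    (hA : ∀ t i, Measurable (Function.uncurry (A.oracle t i))) {s : HashSeeds T n 𝓗 𝓢}
    (hgood : A.GoodRun s k ν f σ G) {m : ℕ} (hm : m ≤ T) :
    MemLp (fun ω => (A.state s ω m).meanErr) 2 (samplesLaw d k T ν) := by
  induction m with
  | zero =>
    have : (fun ω : Samples d k T Z => (A.state s ω 0).meanErr) = fun _ => 0 := by
      ext ω
      simp [state, SGDState.meanErr]
    rw [this]
    exact MemLp.zero
  | succ m ih =>
    have h1 := A.memLp_meanCorrected_of_meanErr hkd hA hgood ⟨m, hm⟩ (ih (by omega))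
    refine h1.of_le (A.measurable_meanErr_state hA s (m + 1)).aestronglyMeasurable
      (.of_forall fun ω => ?_)
    rw [A.state_succ s ω ⟨m, hm⟩]
    exact A.norm_meanErr_step_le hW _ _ _ _

theorem memLp_meanCorrected (hW : 0 < W) (hkd : k ≤ d)
    (hA : ∀ t i, Measurable (Function.uncurry (A.oracle t i))) {s : HashSeeds T n 𝓗 𝓢}
    (hgood : A.GoodRun s k ν f σ G) (t : Fin T) :
    MemLp (fun ω => A.meanCorrected t (ω t).1 (A.state s ω t)) 2 (samplesLaw d k T ν) :=
  A.memLp_meanCorrected_of_meanErr hkd hA hgood t (A.memLp_meanErr hW hkd hA hgood t.2.le)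

theorem memLp_virtual (hW : 0 < W) (hkd : k ≤ d)
    (hA : ∀ t i, Measurable (Function.uncurry (A.oracle t i))) {s : HashSeeds T n 𝓗 𝓢}
    (hgood : A.GoodRun s k ν f σ G) (x : Vec d) {m : ℕ} (hm : m ≤ T) :
    MemLp (fun ω => (A.state s ω m).w - (A.state s ω m).meanErr - x) 2 (samplesLaw d k T ν) := by
  have := isProbabilityMeasure_samplesLaw (T := T) (ν := ν) hkd
  induction m with
  | zero =>
    have : (fun ω : Samples d k T Z => (A.state s ω 0).w - (A.state s ω 0).meanErr - x)
        = fun _ => A.init - x := by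
      ext ω
      simp [state, SGDState.meanErr]
    rw [this]
    exact memLp_const _
  | succ m ih =>
    have h1 := (ih (by omega)).sub
      ((A.memLp_meanOracle hkd hA hgood ⟨m, hm⟩).1.const_smul (A.stepSize ⟨m, hm⟩))
    refine h1.ae_eq (.of_forall fun ω => ?_)
    simp only [Pi.sub_apply, Pi.smul_apply]
    rw [A.state_succ s ω ⟨m, hm⟩, A.w_sub_meanErr_step hW]
    abel

/-- Strong convexity turns the gradient bound along the run into a constant bound on the gap. It
gives integrability, and it settles the regime of few updates. -/
theorem ae_gap_bound (hf : SmoothStronglyConvex f L μ) (hμ : 0 < μ) (hG : 0 ≤ G)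
    {s : HashSeeds T n 𝓗 𝓢} (hgood : A.GoodRun s k ν f σ G) (t : Fin T) :
    ∀ᵐ ω ∂(samplesLaw d k T ν), f (A.iterate s ω t) - f wstar ≤ G ^ 2 / (2 * μ) := by
  filter_upwards [hgood t] with ω hω
  refine (hf.sub_le_norm_sq_gradient hμ _).trans ?_
  have := hω.norm_gradient_le hG
  gcongr

theorem integrable_gap (hkd : k ≤ d) (hf : SmoothStronglyConvex f L μ) (hμ : 0 < μ) (hG : 0 ≤ G)
    (hmin : ∀ w, f wstar ≤ f w)
    (hA : ∀ t i, Measurable (Function.uncurry (A.oracle t i))) {s : HashSeeds T n 𝓗 𝓢}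
    (hgood : A.GoodRun s k ν f σ G) (t : Fin T) :
    Integrable (fun ω => f (A.iterate s ω t) - f wstar) (samplesLaw d k T ν) := by
  have := isProbabilityMeasure_samplesLaw (T := T) (ν := ν) hkd
  refine Integrable.of_bound ((hf.differentiable.continuous.measurable.comp
    (A.measurable_state_w hA s t)).sub_const _).aestronglyMeasurable (G ^ 2 / (2 * μ)) ?_
  filter_upwards [A.ae_gap_bound hf hμ hG hgood t] with ω hω
  rw [Real.norm_eq_abs, abs_of_nonneg (sub_nonneg.mpr (hmin _))]
  exact hω

/-- Resampling component `t` freezes the state and leaves a fresh sample, so the one-step inequality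
applies inside the integral for almost every past. -/
theorem integral_virtual_step_le (hW : 0 < W) (hkd : k ≤ d) (hf : SmoothStronglyConvex f L μ)
    (hμ : 0 < μ) (hL : 0 < L) (hμL : μ ≤ L) (hG : 0 ≤ G) (hmin : ∀ w, f wstar ≤ f w)
    (hγ : 0 < A.γ) (hξ : 0 < A.ξ)
    (hA : ∀ t i, Measurable (Function.uncurry (A.oracle t i))) {s : HashSeeds T n 𝓗 𝓢}
    (hgood : A.GoodRun s k ν f σ G) (t : Fin T) :
    ∫ ω, ‖(A.state s ω (t + 1)).w - (A.state s ω (t + 1)).meanErr - wstar‖ ^ 2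
        ∂(samplesLaw d k T ν)
      ≤ (1 - A.γ / (((t : ℕ) : ℝ) + 1 + A.ξ) * μ / 2) *
          ∫ ω, ‖(A.state s ω t).w - (A.state s ω t).meanErr - wstar‖ ^ 2 ∂(samplesLaw d k T ν)
        - A.γ / (((t : ℕ) : ℝ) + 1 + A.ξ) / 2 *
          ∫ ω, (f (A.iterate s ω t) - f wstar) ∂(samplesLaw d k T ν)
        + 5 * L * (A.γ / (((t : ℕ) : ℝ) + 1 + A.ξ)) *
          ∫ ω, ‖(A.state s ω t).meanErr‖ ^ 2 ∂(samplesLaw d k T ν)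
        + (A.γ / (((t : ℕ) : ℝ) + 1 + A.ξ)) ^ 2 * σ ^ 2
        + 8 * L * A.γ ^ 2 * G ^ 2 / (((t : ℕ) : ℝ) + 1 + A.ξ) ^ 2
          * (A.γ / (((t : ℕ) : ℝ) + 1 + A.ξ)) := by
  have := isProbabilityMeasure_uniformSelection hkd
  have := isProbabilityMeasure_samplesLaw (T := T) (ν := ν) hkd
  set η := A.γ / (((t : ℕ) : ℝ) + 1 + A.ξ) with hη
  have hηt : A.stepSize t = η := rfl
  have sqi : ∀ {h : Samples d k T Z → Vec d}, MemLp h 2 (samplesLaw d k T ν) →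
      Integrable (fun ω => ‖h ω‖ ^ 2) (samplesLaw d k T ν) := fun hh =>
    (memLp_two_iff_integrable_sq_norm hh.1).mp hh
  have i1 := sqi (A.memLp_virtual hW hkd hA hgood wstar t.2)
  have i2 := sqi (A.memLp_virtual hW hkd hA hgood wstar t.2.le)
  have i3 := A.integrable_gap hkd hf hμ hG hmin hA hgood t
  have i4 := sqi (A.memLp_meanErr hW hkd hA hgood t.2.le)
  have hΦ := measurePreserving_update_samples (ν := ν) hkd t
  have hint : Integrable (fun p : Samples d k T Z × (Z × Selection d k) =>
      ‖(A.state s p.1 t).w - (A.state s p.1 t).meanErr - wstar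
        - η • A.meanOracle t (A.state s p.1 t).w p.2.1‖ ^ 2)
      ((samplesLaw d k T ν).prod
        (ν.prod (ProbabilityTheory.uniformOn (Set.univ : Set (Selection d k))))) ∧
      ∫ ω, ‖(A.state s ω (t + 1)).w - (A.state s ω (t + 1)).meanErr - wstar‖ ^ 2
        ∂(samplesLaw d k T ν)
      = ∫ p, ‖(A.state s p.1 t).w - (A.state s p.1 t).meanErr - wstar
          - η • A.meanOracle t (A.state s p.1 t).w p.2.1‖ ^ 2
        ∂((samplesLaw d k T ν).prod
          (ν.prod (ProbabilityTheory.uniformOn (Set.univ : Set (Selection d k))))) := by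
    have hpt : ∀ p : Samples d k T Z × (Z × Selection d k),
        ‖(A.state s (Function.update p.1 t p.2) (t + 1)).w
          - (A.state s (Function.update p.1 t p.2) (t + 1)).meanErr - wstar‖ ^ 2
        = ‖(A.state s p.1 t).w - (A.state s p.1 t).meanErr - wstar
          - η • A.meanOracle t (A.state s p.1 t).w p.2.1‖ ^ 2 := by
      intro p
      rw [A.state_succ, A.w_sub_meanErr_step hW, A.state_update_samples s p.1 t _ le_rfl,
        Function.update_self, hηt]
      congr 2
      abel
    constructor
    · exact ((hΦ.integrable_comp i1.1).mpr i1).congr (.of_forall hpt)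
    · have hmap := integral_map hΦ.measurable.aemeasurable (by rw [hΦ.map_eq]; exact i1.1)
      rw [hΦ.map_eq] at hmap
      exact hmap.trans (integral_congr_ae (.of_forall hpt))
  rw [hint.2, integral_prod _ hint.1]
  have hle : ∀ᵐ ω ∂(samplesLaw d k T ν),
      ∫ y, ‖(A.state s ω t).w - (A.state s ω t).meanErr - wstar
          - η • A.meanOracle t (A.state s ω t).w y.1‖ ^ 2
        ∂(ν.prod (ProbabilityTheory.uniformOn (Set.univ : Set (Selection d k))))
      ≤ (1 - η * μ / 2) * ‖(A.state s ω t).w - (A.state s ω t).meanErr - wstar‖ ^ 2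
        - η / 2 * (f (A.iterate s ω t) - f wstar)
        + 5 * L * η * ‖(A.state s ω t).meanErr‖ ^ 2 + (η ^ 2 * σ ^ 2
        + 8 * L * A.γ ^ 2 * G ^ 2 / (((t : ℕ) : ℝ) + 1 + A.ξ) ^ 2 * η) := by
    filter_upwards [hgood t] with ω hω
    rw [← add_assoc]
    refine le_trans ?_ ((hω.integral_norm_sq_step_le
      ((A.state s ω t).w - (A.state s ω t).meanErr - wstar) η).trans
      (hf.progress_le hμ hL hμL hmin hγ (by positivity) (hω.norm_gradient_le hG) _))
    rw [integral_fun_fst (fun z => ‖(A.state s ω t).w - (A.state s ω t).meanErr - wstar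
          - η • A.meanOracle t (A.state s ω t).w z‖ ^ 2)]
    simp [iterate]
  obtain ⟨hi, he⟩ := integral_affine_three i2 i3 i4 (1 - η * μ / 2) (η / 2) (5 * L * η)
    (η ^ 2 * σ ^ 2 + 8 * L * A.γ ^ 2 * G ^ 2 / (((t : ℕ) : ℝ) + 1 + A.ξ) ^ 2 * η)
  refine (integral_mono_ae hint.1.integral_prod_left hi hle).trans_eq ?_
  rw [he, ← add_assoc]

/-! ### Contraction of the error -/

open Classical in
/-- The part of the second moment of the corrected gradient on which the sketch fails. -/
noncomputable def failureMoment (k : ℕ) (ν : Measure Z) (s : HashSeeds T n 𝓗 𝓢) (t : Fin T) : ℝ :=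
  ∫ ω : Samples d k T Z, (if (A.hash (s t)).Faithful k (A.meanCorrected t (ω t).1 (A.state s ω t))
    then 0 else ‖A.meanCorrected t (ω t).1 (A.state s ω t)‖ ^ 2) ∂(samplesLaw d k T ν)

open Classical in
theorem integrable_failure (hW : 0 < W) (hkd : k ≤ d)
    (hA : ∀ t i, Measurable (Function.uncurry (A.oracle t i))) {s : HashSeeds T n 𝓗 𝓢}
    (hgood : A.GoodRun s k ν f σ G) (t : Fin T) (u : Fin (2 * n + 1) → 𝓗 × 𝓢) :
    Measurable (fun ω : Samples d k T Z =>
      if (A.hash u).Faithful k (A.meanCorrected t (ω t).1 (A.state s ω t))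
      then 0 else ‖A.meanCorrected t (ω t).1 (A.state s ω t)‖ ^ 2) ∧
    Integrable (fun ω : Samples d k T Z =>
      if (A.hash u).Faithful k (A.meanCorrected t (ω t).1 (A.state s ω t))
      then 0 else ‖A.meanCorrected t (ω t).1 (A.state s ω t)‖ ^ 2) (samplesLaw d k T ν) := by
  have hm := A.measurable_meanCorrected_state (k := k) hA s t
  have hL := A.memLp_meanCorrected hW hkd hA hgood t
  have hi := (memLp_two_iff_integrable_sq_norm hL.1).mp hL
  have h1 : Measurable (fun ω : Samples d k T Z =>
      if (A.hash u).Faithful k (A.meanCorrected t (ω t).1 (A.state s ω t))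
      then 0 else ‖A.meanCorrected t (ω t).1 (A.state s ω t)‖ ^ 2) :=
    Measurable.ite (hm ((A.hash u).measurableSet_faithful k)) measurable_const
      (hm.norm.pow_const 2)
  refine ⟨h1, hi.mono h1.aestronglyMeasurable (.of_forall fun ω => ?_)⟩
  split_ifs
  · simp
  · rfl

/-- Where the sketch is faithful the selection contracts; elsewhere the error norm merely does not
increase, and the failure moment restores the missing k/(16d) share. -/
theorem integral_meanErr_succ_le (hW : 0 < W) (hk : 0 < k) (hkd : k ≤ d)
    (hA : ∀ t i, Measurable (Function.uncurry (A.oracle t i))) {s : HashSeeds T n 𝓗 𝓢}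
    (hgood : A.GoodRun s k ν f σ G) (t : Fin T) :
    ∫ ω, ‖(A.state s ω (t + 1)).meanErr‖ ^ 2 ∂(samplesLaw d k T ν)
      ≤ (1 - (k : ℝ) / (16 * d)) *
          ∫ ω, ‖A.meanCorrected t (ω t).1 (A.state s ω t)‖ ^ 2 ∂(samplesLaw d k T ν)
        + (k : ℝ) / (16 * d) * A.failureMoment k ν s t := by
  classical
  have hm := A.measurable_meanCorrected_state (k := k) hA s t
  have hL := A.memLp_meanCorrected hW hkd hA hgood t
  have hi := (memLp_two_iff_integrable_sq_norm hL.1).mp hL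
  obtain ⟨fm, fi⟩ := A.integrable_failure hW hkd hA hgood t (s t)
  have hd : (0 : ℝ) < d := by exact_mod_cast hk.trans_le hkd
  have hkd' : (k : ℝ) ≤ d := by exact_mod_cast hkd
  have hα : (k : ℝ) / (16 * d) ≤ 1 := by
    rw [div_le_one (by positivity)]; linarith
  have hα0 : 0 ≤ (k : ℝ) / (16 * d) := by positivity
  have hα1 : 0 ≤ 1 - (k : ℝ) / (16 * d) := by linarith
  rw [failureMoment, ← integral_const_mul, ← integral_const_mul,
    ← integral_add (hi.const_mul _) (fi.const_mul _)]
  refine integral_le_of_sum_selection_le hkd t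
    ((A.measurable_meanErr_state hA s (t + 1)).norm.pow_const 2)
    (((hm.norm.pow_const 2).const_mul _).add (fm.const_mul _)) (fun ω => sq_nonneg _)
    (fun ω => ?_) ((hi.const_mul _).add (fi.const_mul _)) (fun ω z => ?_)
  · refine add_nonneg (mul_nonneg hα1 (sq_nonneg _)) (mul_nonneg hα0 ?_)
    split_ifs
    · exact le_rfl
    · exact sq_nonneg _
  · simp only [A.state_succ, A.norm_sq_meanErr_step hW, A.top_eq,
      A.state_update_samples s ω t _ le_rfl, Function.update_self]
    set a := A.meanCorrected t z (A.state s ω t)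
    by_cases hF : (A.hash (s t)).Faithful k a
    · simp only [if_pos hF, mul_zero, add_zero, Finset.sum_const, Finset.card_univ, nsmul_eq_mul]
      exact Selection.sum_residual_le hk hkd _ a hF
    · simp only [if_neg hF]
      refine Finset.sum_le_sum fun σ _ => ?_
      have : 0 ≤ ∑ j ∈ (σ ((A.hash (s t)).heavy k ((A.hash (s t)).sketch a))).1, a j ^ 2 :=
        Finset.sum_nonneg fun _ _ => sq_nonneg _
      linarith

end Moments

end SketchedSGD

namespace SketchedSGD

/-! ### Contraction for most hash functions -/

section Hash

variable {d k W T n : ℕ} {Z 𝓗 𝓢 : Type*} [MeasurableSpace Z] {ν : Measure Z}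
  [IsProbabilityMeasure ν] [Fintype 𝓗] [Fintype 𝓢] {f : Vec d → ℝ} {σ G δ : ℝ}
  (A : SketchedSGD d W T n (256 * k) Z 𝓗 𝓢)

/-- The vector being compressed is unchanged when the seeds of update `t` vary, so sum and integral
may be exchanged and the bound for one fixed vector applies pointwise. -/
theorem sum_failureMoment_update_le (hW : 0 < W) (hk : 0 < k) (hkd : k ≤ d) (hT : 0 < T)
    (hδ : 0 < δ) (hn : (d : ℝ) * T / δ ≤ 4 ^ n)
    (hb : KWiseIndependent 2 A.bucketFamily) (hs : KWiseIndependent 4 A.signFamily)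
    (hA : ∀ t i, Measurable (Function.uncurry (A.oracle t i))) {s : HashSeeds T n 𝓗 𝓢}
    (hgood : A.GoodRun s k ν f σ G) (t : Fin T) :
    ∑ u, A.failureMoment k ν (Function.update s t u) t
      ≤ δ / (2 * T) * Fintype.card (Fin (2 * n + 1) → 𝓗 × 𝓢) *
        ∫ ω, ‖A.meanCorrected t (ω t).1 (A.state s ω t)‖ ^ 2 ∂(samplesLaw d k T ν) := by
  classical
  have hd : 0 < d := hk.trans_le hkd
  have hL := A.memLp_meanCorrected hW hkd hA hgood t
  have hi := (memLp_two_iff_integrable_sq_norm hL.1).mp hL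
  simp only [failureMoment, A.state_update_seeds s _ t _ le_rfl, Function.update_self]
  rw [← integral_finsetSum _ fun u _ => (A.integrable_failure hW hkd hA hgood t u).2,
    ← integral_const_mul]
  refine integral_mono (integrable_finsetSum _ fun u _ =>
    (A.integrable_failure hW hkd hA hgood t u).2) (hi.const_mul _) fun ω => ?_
  simp only
  set a := A.meanCorrected t (ω t).1 (A.state s ω t)
  have h1 : ∑ u : Fin (2 * n + 1) → 𝓗 × 𝓢, (if (A.hash u).Faithful k a then 0 else ‖a‖ ^ 2)
      = (Finset.univ.filter fun u : Fin (2 * n + 1) → 𝓗 × 𝓢 =>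
          ¬ (A.hash u).Faithful k a).card * ‖a‖ ^ 2 := by
    rw [← nsmul_eq_mul, ← Finset.sum_const, Finset.sum_filter]
    exact Finset.sum_congr rfl fun u _ => by rw [ite_not]
  rw [h1]
  exact mul_le_mul_of_nonneg_right (A.card_not_faithful_le_div hk hd hT hδ hn hb hs a)
    (sq_nonneg _)

open Classical in
/-- Seeds for which the sketches of update `t` fail on a large part of the second moment. -/
noncomputable def failingSeeds (k : ℕ) (ν : Measure Z) (t : Fin T) :
    Finset (HashSeeds T n 𝓗 𝓢) :=
  Finset.univ.filter fun s =>
    1 / 2 * ∫ ω, ‖A.meanCorrected t (ω t).1 (A.state s ω t)‖ ^ 2 ∂(samplesLaw d k T ν)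
      < A.failureMoment k ν s t

theorem card_failingSeeds_le [Nonempty 𝓗] [Nonempty 𝓢]
    (hW : 0 < W) (hk : 0 < k) (hkd : k ≤ d) (hT : 0 < T)
    (hδ : 0 < δ) (hn : (d : ℝ) * T / δ ≤ 4 ^ n)
    (hb : KWiseIndependent 2 A.bucketFamily) (hs : KWiseIndependent 4 A.signFamily)
    (hA : ∀ t i, Measurable (Function.uncurry (A.oracle t i)))
    (hgood : ∀ s, A.GoodRun s k ν f σ G) (t : Fin T) :
    ((A.failingSeeds k ν t).card : ℝ) ≤ δ / T * Fintype.card (HashSeeds T n 𝓗 𝓢) := by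
  classical
  set N : ℝ := (Fintype.card (Fin (2 * n + 1) → 𝓗 × 𝓢) : ℝ) with hN
  have hN0 : 0 < N := by rw [hN]; exact_mod_cast Fintype.card_pos
  have hT' : (0 : ℝ) < T := by exact_mod_cast hT
  have hfib : ∀ s : HashSeeds T n 𝓗 𝓢,
      (∑ u, if Function.update s t u ∈ A.failingSeeds k ν t then (1 : ℝ) else 0)
        ≤ δ / T * N := by
    intro s
    set a := ∫ ω, ‖A.meanCorrected t (ω t).1 (A.state s ω t)‖ ^ 2 ∂(samplesLaw d k T ν) with ha
    have ha0 : 0 ≤ a := integral_nonneg fun _ => sq_nonneg _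
    have hmem : ∀ u, Function.update s t u ∈ A.failingSeeds k ν t ↔
        1 / 2 * a < A.failureMoment k ν (Function.update s t u) t := by
      intro u
      simp [failingSeeds, ha, A.state_update_seeds s _ t _ le_rfl]
    have hnonneg : ∀ s, 0 ≤ A.failureMoment k ν s t := by
      intro s
      refine integral_nonneg fun ω => ?_
      simp only [Pi.zero_apply]
      split_ifs
      · exact le_rfl
      · exact sq_nonneg _
    have h1 := (card_lt_mul_le_sum (fun u => A.failureMoment k ν (Function.update s t u) t)
      (fun u => hnonneg _) (1 / 2 * a)).trans
      (A.sum_failureMoment_update_le hW hk hkd hT hδ hn hb hs hA (hgood s) t)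
    simp_rw [hmem]
    rw [Finset.sum_boole]
    -- Markov's inequality would divide by the second moment. If that is zero, the failure moments
    -- vanish and the strict inequality in `failingSeeds` excludes every seed.
    rcases ha0.eq_or_lt with h0 | h0
    · rw [Finset.filter_false_of_mem]
      · simp only [Finset.card_empty, Nat.cast_zero]; positivity
      · intro u _
        rw [← h0, mul_zero, not_lt]
        have h2 := A.sum_failureMoment_update_le hW hk hkd hT hδ hn hb hs hA (hgood s) t
        rw [← ha, ← h0, mul_zero] at h2
        exact (Finset.single_le_sum (fun u _ => hnonneg _) (Finset.mem_univ u)).trans h2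
    · have h2 : δ / (2 * T) * N * a = δ / T * N * (1 / 2 * a) := by field_simp
      rw [← ha, ← hN, h2] at h1
      exact le_of_mul_le_mul_right h1 (by positivity)
  have h2 := Fintype.sum_sum_update t
    (fun s : HashSeeds T n 𝓗 𝓢 => if s ∈ A.failingSeeds k ν t then (1 : ℝ) else 0)
  have h3 : N * (A.failingSeeds k ν t).card ≤ N * (δ / T * Fintype.card (HashSeeds T n 𝓗 𝓢)) := by
    have h4 : ∑ s : HashSeeds T n 𝓗 𝓢, (if s ∈ A.failingSeeds k ν t then (1 : ℝ) else 0)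
        = (A.failingSeeds k ν t).card := by simp
    rw [h4, nsmul_eq_mul] at h2
    rw [hN, ← h2]
    refine (Finset.sum_le_sum fun s _ => hfib s).trans_eq ?_
    rw [Finset.sum_const, nsmul_eq_mul, Finset.card_univ, hN]
    ring
  exact le_of_mul_le_mul_left h3 hN0

end Hash

/-! ### Convergence for fixed hash functions -/

theorem sum_weight_pos {d W T n B : ℕ} {Z 𝓗 𝓢 : Type*}
    (A : SketchedSGD d W T n B Z 𝓗 𝓢) (hT : 0 < T) (hξ : 0 < A.ξ) : 0 < ∑ t : Fin T, A.weight t := by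
  have : Nonempty (Fin T) := ⟨⟨0, hT⟩⟩
  refine Finset.sum_pos (fun t _ => ?_) Finset.univ_nonempty
  unfold weight
  positivity

section Convergence

variable {d k W T n B : ℕ} {Z 𝓗 𝓢 : Type*} [MeasurableSpace Z] {ν : Measure Z}
  [IsProbabilityMeasure ν] {f : Vec d → ℝ} {L μ σ G : ℝ} {wstar : Vec d}
  (A : SketchedSGD d W T n B Z 𝓗 𝓢)

theorem integral_norm_sq_meanErr_le (hW : 0 < W) (hk : 0 < k) (hkd : k ≤ d) {c : ℝ} (hc : 0 < c)
    (hξ : c * ((d : ℝ) / k) ≤ A.ξ)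
    (hA : ∀ t i, Measurable (Function.uncurry (A.oracle t i))) {s : HashSeeds T n 𝓗 𝓢}
    (hgood : A.GoodRun s k ν f σ G)
    (hs : ∀ t, A.failureMoment k ν s t
      ≤ 1 / 2 * ∫ ω, ‖A.meanCorrected t (ω t).1 (A.state s ω t)‖ ^ 2 ∂(samplesLaw d k T ν)) :
    ∀ t ≤ T, ∫ ω, ‖(A.state s ω t).meanErr‖ ^ 2 ∂(samplesLaw d k T ν)
      ≤ 16384 * (1 + 384 / c) ^ 2 * ((d : ℝ) / k) ^ 2 * (A.γ ^ 2 * G ^ 2)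
        / ((t : ℝ) + 1 + A.ξ) ^ 2 := by
  have hk' : (0 : ℝ) < k := by exact_mod_cast hk
  have hkd' : (k : ℝ) ≤ d := by exact_mod_cast hkd
  have hr : 1 ≤ (d : ℝ) / k := by rwa [one_le_div hk']
  set r := (d : ℝ) / k with hrdef
  have hr0 : 0 < r := by linarith
  have hξ0 : 0 < A.ξ := lt_of_lt_of_le (by positivity) hξ
  refine error_recursion_le hr hc hξ (by positivity) ?_ ?_
  · simp [state, SGDState.meanErr]
  intro t ht
  have sqi : ∀ {h : Samples d k T Z → Vec d}, MemLp h 2 (samplesLaw d k T ν) →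
      Integrable (fun ω => ‖h ω‖ ^ 2) (samplesLaw d k T ν) := fun hh =>
    (memLp_two_iff_integrable_sq_norm hh.1).mp hh
  have i1 := sqi (A.memLp_meanErr hW hkd hA hgood ht.le)
  obtain ⟨l2, hg⟩ := A.memLp_meanOracle hkd hA hgood ⟨t, ht⟩
  have i2 := sqi l2
  have i3 := sqi (A.memLp_meanCorrected hW hkd hA hgood ⟨t, ht⟩)
  have h1 := A.integral_meanErr_succ_le hW hk hkd hA hgood ⟨t, ht⟩
  have h2 := hs ⟨t, ht⟩
  have hαr : (k : ℝ) / (16 * d) = 1 / (16 * r) := by rw [hrdef]; field_simp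
  rw [hαr] at h1
  set η := A.stepSize ⟨t, ht⟩ with hη
  have hηval : η ^ 2 = A.γ ^ 2 / ((t : ℝ) + 1 + A.ξ) ^ 2 := by
    rw [hη, stepSize, div_pow]
  have hc0 : 0 < 1 / (64 * r) := by positivity
  -- Young's parameter 1/(64r) spends half of the contraction 1/(32r), which is what remains after
  -- the failure moment has taken half of 1/(16r).
  have h3 : ∫ ω, ‖A.meanCorrected ⟨t, ht⟩ (ω ⟨t, ht⟩).1 (A.state s ω t)‖ ^ 2
        ∂(samplesLaw d k T ν)
      ≤ (1 + 1 / (64 * r)) * ∫ ω, ‖(A.state s ω t).meanErr‖ ^ 2 ∂(samplesLaw d k T ν)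
        + (1 + 64 * r) * (η ^ 2 * G ^ 2) := by
    have h4 : ∀ ω : Samples d k T Z,
        ‖A.meanCorrected ⟨t, ht⟩ (ω ⟨t, ht⟩).1 (A.state s ω t)‖ ^ 2
        ≤ (1 + 1 / (64 * r)) * ‖(A.state s ω t).meanErr‖ ^ 2
          + (1 + 64 * r) * η ^ 2 * ‖A.meanOracle ⟨t, ht⟩ (A.state s ω t).w (ω ⟨t, ht⟩).1‖ ^ 2 := by
      intro ω
      have h5 := norm_add_sq_le_weighted (A.state s ω t).meanErr
        (η • A.meanOracle ⟨t, ht⟩ (A.state s ω t).w (ω ⟨t, ht⟩).1) hc0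
      rw [norm_smul, mul_pow, Real.norm_eq_abs, sq_abs, one_div_one_div, add_comm _ (η • _)] at h5
      refine h5.trans_eq ?_
      ring
    refine (integral_mono i3 ((i1.const_mul _).add (i2.const_mul _)) h4).trans ?_
    refine (integral_add (i1.const_mul _) (i2.const_mul _)).le.trans ?_
    rw [integral_const_mul, integral_const_mul]
    have h6 : (1 + 64 * r) * η ^ 2 *
        ∫ ω, ‖A.meanOracle ⟨t, ht⟩ (A.state s ω t).w (ω ⟨t, ht⟩).1‖ ^ 2 ∂(samplesLaw d k T ν)
        ≤ (1 + 64 * r) * η ^ 2 * G ^ 2 := by gcongr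
    linarith
  set E := ∫ ω, ‖(A.state s ω t).meanErr‖ ^ 2 ∂(samplesLaw d k T ν)
  set C := ∫ ω, ‖A.meanCorrected ⟨t, ht⟩ (ω ⟨t, ht⟩).1 (A.state s ω t)‖ ^ 2 ∂(samplesLaw d k T ν)
  have hE0 : 0 ≤ E := integral_nonneg fun _ => sq_nonneg _
  have h5 : (1 - 1 / (16 * r)) * C + 1 / (16 * r) * A.failureMoment k ν s ⟨t, ht⟩
      ≤ (1 - 1 / (32 * r)) * C := by
    have := mul_le_mul_of_nonneg_left h2 (by positivity : 0 ≤ 1 / (16 * r))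
    have h6 : 1 / (16 * r) * (1 / 2 * C) = 1 / (32 * r) * C := by field_simp; ring
    have h7 : 1 / (16 * r) * C = 2 * (1 / (32 * r) * C) := by field_simp; ring
    linarith
  have hq : 0 ≤ 1 - 1 / (32 * r) := by
    rw [sub_nonneg, div_le_one (by positivity)]; linarith
  have h6 := (h1.trans h5).trans (mul_le_mul_of_nonneg_left h3 hq)
  refine h6.trans ?_
  have h7 : A.γ ^ 2 * G ^ 2 / ((t : ℝ) + 1 + A.ξ) ^ 2 = η ^ 2 * G ^ 2 := by rw [hηval]; ring
  rw [h7, mul_add]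
  have h8 : (1 - 1 / (32 * r)) * ((1 + 1 / (64 * r)) * E)
      = (1 - 1 / (64 * r)) * E - 1 / (2048 * r ^ 2) * E := by field_simp; ring
  have h9 : (1 - 1 / (32 * r)) * ((1 + 64 * r) * (η ^ 2 * G ^ 2))
      = 64 * r * (η ^ 2 * G ^ 2) - (1 + 1 / (32 * r)) * (η ^ 2 * G ^ 2) := by field_simp; ring
  have h10 : 0 ≤ 1 / (2048 * r ^ 2) * E := by positivity
  have h11 : 0 ≤ (1 + 1 / (32 * r)) * (η ^ 2 * G ^ 2) := by positivity
  linarith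

theorem integrable_output (hkd : k ≤ d) (hT : 0 < T) (hf : SmoothStronglyConvex f L μ)
    (hμ : 0 < μ) (hG : 0 ≤ G) (hmin : ∀ w, f wstar ≤ f w) (hξ : 0 < A.ξ)
    (hA : ∀ t i, Measurable (Function.uncurry (A.oracle t i))) {s : HashSeeds T n 𝓗 𝓢}
    (hgood : A.GoodRun s k ν f σ G) :
    Integrable (fun ω => f (A.output s ω)) (samplesLaw d k T ν) ∧
      ∫ ω, f (A.output s ω) ∂(samplesLaw d k T ν) - f wstar
        ≤ (∑ t : Fin T, A.weight t)⁻¹ * ∑ t : Fin T, A.weight t *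
          ∫ ω, (f (A.iterate s ω t) - f wstar) ∂(samplesLaw d k T ν) := by
  have := isProbabilityMeasure_samplesLaw (T := T) (ν := ν) hkd
  have hQ := A.sum_weight_pos hT hξ
  have hq : ∀ t, 0 ≤ A.weight t := fun t => sq_nonneg _
  have hint : ∀ t, Integrable (fun ω => f (A.iterate s ω t) - f wstar) (samplesLaw d k T ν) :=
    fun t => A.integrable_gap hkd hf hμ hG hmin hA hgood t
  have hbd : Integrable (fun ω => (∑ t : Fin T, A.weight t)⁻¹ * ∑ t : Fin T, A.weight t *
      (f (A.iterate s ω t) - f wstar)) (samplesLaw d k T ν) :=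
    (integrable_finsetSum _ fun t _ => (hint t).const_mul _).const_mul _
  have hjensen : ∀ ω : Samples d k T Z, f (A.output s ω) - f wstar
      ≤ (∑ t : Fin T, A.weight t)⁻¹ * ∑ t : Fin T, A.weight t *
        (f (A.iterate s ω t) - f wstar) :=
    fun ω => hf.map_weighted_sub_le hμ.le _ hq hQ _ _
  have hmeas : Measurable fun ω : Samples d k T Z => A.output s ω := by
    have h : Measurable fun ω : Samples d k T Z => ∑ t : Fin T, A.weight t • A.iterate s ω t :=
      Finset.measurable_fun_sum _ fun t _ => by
        have := A.measurable_state_w (k := k) hA s t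
        exact this.const_smul (A.weight t)
    exact h.const_smul (∑ t : Fin T, A.weight t)⁻¹
  have hgap : Integrable (fun ω => f (A.output s ω) - f wstar) (samplesLaw d k T ν) := by
    refine hbd.mono' ((hf.differentiable.continuous.measurable.comp
      hmeas).sub_const _).aestronglyMeasurable (.of_forall fun ω => ?_)
    rw [Real.norm_eq_abs, abs_of_nonneg (sub_nonneg.mpr (hmin _))]
    exact hjensen ω
  have hout : Integrable (fun ω => f (A.output s ω)) (samplesLaw d k T ν) := by
    refine (hgap.add (integrable_const (f wstar))).congr (.of_forall fun ω => ?_)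
    simp
  refine ⟨hout, ?_⟩
  have h1 := integral_mono hgap hbd hjensen
  rw [integral_sub hout (integrable_const _), integral_const_mul,
    integral_finsetSum _ fun t _ => (hint t).const_mul _] at h1
  simpa [integral_const_mul] using h1

theorem norm_gradient_init_le (hkd : k ≤ d) (hT : 0 < T) (hG : 0 ≤ G) {s : HashSeeds T n 𝓗 𝓢}
    (hgood : A.GoodRun s k ν f σ G) : ‖gradient f A.init‖ ≤ G := by
  have := isProbabilityMeasure_samplesLaw (T := T) (ν := ν) hkd
  obtain ⟨ω, hω⟩ := (hgood ⟨0, hT⟩).exists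
  exact hω.norm_gradient_le hG

theorem integral_output_le (hW : 0 < W) (hk : 0 < k) (hkd : k ≤ d) (hT : 0 < T)
    (hf : SmoothStronglyConvex f L μ) (hμ : 0 < μ) (hL : 0 < L) (hG : 0 ≤ G)
    (hmin : ∀ w, f wstar ≤ f w) {c M : ℝ} (hc : 0 < c) (hγ8 : 8 ≤ A.γ * μ) (hγM : A.γ * μ ≤ M)
    (hξ : c * ((d : ℝ) / k) ≤ A.ξ) (hξM : A.ξ ≤ M * ((d : ℝ) / k))
    (hA : ∀ t i, Measurable (Function.uncurry (A.oracle t i))) {s : HashSeeds T n 𝓗 𝓢}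
    (hgood : A.GoodRun s k ν f σ G)
    (hs : ∀ t, A.failureMoment k ν s t
      ≤ 1 / 2 * ∫ ω, ‖A.meanCorrected t (ω t).1 (A.state s ω t)‖ ^ 2 ∂(samplesLaw d k T ν)) :
    ∫ ω, f (A.output s ω) ∂(samplesLaw d k T ν) - f wstar
      ≤ (6 * (M ^ 3 / 2 + M * (1 + M) + (5 * (16384 * (1 + 384 / c) ^ 2) + 8) * M ^ 2) + 1)
        * (σ ^ 2 / (μ * T) + ((d : ℝ) / k) ^ 2 * G ^ 2 * L / (μ ^ 2 * T ^ 2)) := by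
  have := isProbabilityMeasure_samplesLaw (T := T) (ν := ν) hkd
  have hk' : (0 : ℝ) < k := by exact_mod_cast hk
  have hT' : (0 : ℝ) < T := by exact_mod_cast hT
  have hkd' : (k : ℝ) ≤ d := by exact_mod_cast hkd
  have hr : 1 ≤ (d : ℝ) / k := by rwa [one_le_div hk']
  have herr := A.integral_norm_sq_meanErr_le hW hk hkd hc hξ hA hgood hs
  set r := (d : ℝ) / k
  have hr0 : 0 < r := by linarith
  have hξ0 : 0 < A.ξ := lt_of_lt_of_le (by positivity) hξ
  have hγ : 0 < A.γ := by
    by_contra! h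
    nlinarith
  have hM : 0 ≤ M := by linarith
  have hμL := hf.strong_le_smooth (hk.trans_le hkd)
  refine (A.integrable_output hkd hT hf hμ hG hmin hξ0 hA hgood).2.trans ?_
  have hQ0 := A.sum_weight_pos hT hξ0
  set K := 16384 * (1 + 384 / c) ^ 2 with hK
  set V := σ ^ 2 / (μ * T) + r ^ 2 * G ^ 2 * L / (μ ^ 2 * T ^ 2) with hV
  have hV0 : 0 ≤ V := by positivity
  set C₀ := 6 * (M ^ 3 / 2 + M * (1 + M) + (5 * K + 8) * M ^ 2) with hC₀
  have hC₀0 : 0 ≤ C₀ := by positivity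
  rcases le_total r T with hrT | hrT
  -- The recursion is informative only for r ≤ T. For r ≥ T, the constant gap bound is at most the
  -- second term of the rate, because r/T ≥ 1 and L/μ ≥ 1.
  · have hsum := sum_weighted_gap_le (T := T) (K := K) (r := r) (σ := σ) (G := G)
      (D := fun t => ∫ ω, ‖(A.state s ω t).w - (A.state s ω t).meanErr - wstar‖ ^ 2
        ∂(samplesLaw d k T ν))
      (E := fun t => ∫ ω, ‖(A.state s ω t).meanErr‖ ^ 2 ∂(samplesLaw d k T ν))
      (e := fun t => ∫ ω, (f (A.state s ω t).w - f wstar) ∂(samplesLaw d k T ν))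
      hγ hγ8 hξ0.le hL hr (fun t => integral_nonneg fun _ => sq_nonneg _)
      (fun t ht => herr t ht.le)
      (fun t ht => A.integral_virtual_step_le hW hkd hf hμ hL hμL hG hmin hγ hξ0 hA hgood ⟨t, ht⟩)
    have hD0 : ∫ ω : Samples d k T Z, ‖(A.state s ω 0).w - (A.state s ω 0).meanErr - wstar‖ ^ 2
        ∂(samplesLaw d k T ν) = ‖A.init - wstar‖ ^ 2 := by
      simp [state, SGDState.meanErr]
    have hQ := cube_le_three_mul_sum_sq hξ0.le T
    rw [Finset.sum_range] at hsum hQ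
    rw [hD0] at hsum
    have hD : ‖A.init - wstar‖ ^ 2 ≤ 4 * G ^ 2 / μ ^ 2 := by
      refine (hf.norm_sub_sq_le hμ hmin _).trans ?_
      have := A.norm_gradient_init_le hkd hT hG hgood
      gcongr
    have := rate_le hT hμ hμL hM (by positivity : 0 ≤ K) hr0.le hrT hγ8 hγM hξ0.le hξM
      (sq_nonneg _) hD hQ hsum
    exact this.trans (mul_le_mul_of_nonneg_right (by linarith) hV0)
  · have h1 : ∀ t : Fin T, ∫ ω, (f (A.iterate s ω t) - f wstar) ∂(samplesLaw d k T ν)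
        ≤ G ^ 2 / (2 * μ) := by
      intro t
      have := integral_mono_ae (A.integrable_gap hkd hf hμ hG hmin hA hgood t)
        (integrable_const (G ^ 2 / (2 * μ))) (A.ae_gap_bound hf hμ hG hgood t)
      simpa using this
    have h2 : (∑ t : Fin T, A.weight t)⁻¹ * ∑ t : Fin T, A.weight t *
        ∫ ω, (f (A.iterate s ω t) - f wstar) ∂(samplesLaw d k T ν) ≤ G ^ 2 / (2 * μ) := by
      rw [inv_mul_le_iff₀ hQ0, Finset.sum_mul]
      exact Finset.sum_le_sum fun t _ => mul_le_mul_of_nonneg_left (h1 t) (sq_nonneg _)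
    have h3 : G ^ 2 / (2 * μ) ≤ r ^ 2 * G ^ 2 * L / (μ ^ 2 * T ^ 2) := by
      have h4 : r ^ 2 * G ^ 2 * L / (μ ^ 2 * T ^ 2) = G ^ 2 / μ * ((r / T) ^ 2 * (L / μ)) := by
        field_simp
      have h5 : 1 ≤ r / T := by rwa [one_le_div hT']
      have h6 : 1 ≤ L / μ := by rwa [one_le_div hμ]
      have h7 : 1 ≤ (r / T) ^ 2 * (L / μ) := one_le_mul_of_one_le_of_one_le (one_le_pow₀ h5) h6
      have h8 : G ^ 2 / (2 * μ) ≤ G ^ 2 / μ := by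
        gcongr
        linarith
      rw [h4]
      exact h8.trans (le_mul_of_one_le_right (by positivity) h7)
    have h4 : 0 ≤ σ ^ 2 / (μ * T) := by positivity
    calc _ ≤ G ^ 2 / (2 * μ) := h2
      _ ≤ 1 * V := by rw [hV]; linarith
      _ ≤ (C₀ + 1) * V := mul_le_mul_of_nonneg_right (by linarith) hV0

end Convergence

end SketchedSGD

/-! ### Counting with the uniform measure -/

theorem one_sub_le_uniformOn_univ_real {Ω : Type*} [Fintype Ω] [Nonempty Ω] [MeasurableSpace Ω]
    [MeasurableSingletonClass Ω] {δ : ℝ} {bad : Finset Ω} {S : Set Ω}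
    (hbad : (bad.card : ℝ) ≤ δ * Fintype.card Ω) (hS : ∀ ω ∉ bad, ω ∈ S) :
    1 - δ ≤ (ProbabilityTheory.uniformOn (Set.univ : Set Ω)).real S := by
  classical
  have : IsProbabilityMeasure (ProbabilityTheory.uniformOn (Set.univ : Set Ω)) :=
    ProbabilityTheory.isProbabilityMeasure_uniformOn Set.finite_univ Set.univ_nonempty
  have h1 : (ProbabilityTheory.uniformOn (Set.univ : Set Ω)).real (bad : Set Ω)
      = bad.card / Fintype.card Ω := by
    rw [measureReal_def, ProbabilityTheory.uniformOn_univ, Measure.count_apply_finset]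
    simp
  have hpos : (0 : ℝ) < Fintype.card Ω := by exact_mod_cast Fintype.card_pos
  have h2 : (bad.card : ℝ) / Fintype.card Ω ≤ δ := by rwa [div_le_iff₀ hpos]
  have h3 := probReal_compl_eq_one_sub (μ := ProbabilityTheory.uniformOn (Set.univ : Set Ω))
    (s := (bad : Set Ω)) bad.measurableSet
  have h4 : (ProbabilityTheory.uniformOn (Set.univ : Set Ω)).real (bad : Set Ω)ᶜ
      ≤ (ProbabilityTheory.uniformOn (Set.univ : Set Ω)).real S :=
    measureReal_mono fun ω hω => hS ω (by simpa using hω)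
  linarith

/-! ### Communication -/

namespace SketchedSGD

variable {d k W T n B : ℕ} {Z 𝓗 𝓢 : Type*} (A : SketchedSGD d W T n B Z 𝓗 𝓢)

theorem communication_eq (p : ℕ) (s : HashSeeds T n 𝓗 𝓢) (ω : Samples d k T Z) (t : Fin T) :
    A.communication p s ω t
      = W * ((2 * n + 1) * B * p + k * Nat.clog 2 d + k * p + k * (Nat.clog 2 d + p)) := by
  have hcard : (A.top t (s t) (ω t) (A.state s ω t)).card = k := by
    rw [top]
    exact ((ω t).2 _).2.1
  have hi : ∀ i : Fin W,
      ((A.workerMessages t (s t) (ω t) (A.state s ω t) i).map (Message.bits p)).sum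
      = (2 * n + 1) * B * p + k * Nat.clog 2 d + k * p + k * (Nat.clog 2 d + p) := by
    intro i
    simp only [workerMessages, List.map_append, List.sum_append, List.map_flatten, List.map_map,
      List.map_replicate,
      Function.comp_def, Message.bits, List.map_const', List.flatMap_def,
      List.sum_flatten, List.map_cons, List.map_nil, List.sum_cons, List.sum_nil,
      List.sum_replicate, List.length_finRange, smul_eq_mul, Finset.length_toList, hcard]
    ring
  rw [communication, Finset.sum_congr rfl fun i _ => hi i]
  simp

end SketchedSGD

/-- From dT ≥ 2 the logarithm is at least log 2 > 1/2, so it dominates constants and the rounding in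
the index length. Without this it could be arbitrarily close to zero. -/
theorem clog_le_four_mul_log {d T : ℕ} {δ : ℝ} (hd : 0 < d) (hdT : 2 ≤ d * T) (hδ : 0 < δ)
    (hδ1 : δ < 1) : (Nat.clog 2 d : ℝ) ≤ 4 * Real.log ((d : ℝ) * T / δ) ∧
      1 ≤ 2 * Real.log ((d : ℝ) * T / δ) := by
  have h2 : (2 : ℝ) ≤ (d : ℝ) * T := by exact_mod_cast hdT
  have h3 : (d : ℝ) * T ≤ d * T / δ := by
    rw [le_div_iff₀ hδ]
    exact mul_le_of_le_one_right (by positivity) hδ1.le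
  have hlog2 := Real.log_two_gt_d9
  have h4 : Real.log 2 ≤ Real.log ((d : ℝ) * T / δ) :=
    Real.log_le_log (by norm_num) (h2.trans h3)
  refine ⟨?_, by linarith⟩
  have hT : 1 ≤ T := Nat.pos_of_ne_zero (by rintro rfl; simp at hdT)
  have h5 : Real.log d ≤ Real.log ((d : ℝ) * T / δ) := by
    refine Real.log_le_log (by exact_mod_cast hd) (le_trans ?_ h3)
    exact le_mul_of_one_le_right (by positivity) (by exact_mod_cast hT)
  have h6 : (Nat.clog 2 d : ℝ) * Real.log 2 ≤ Real.log d + Real.log 2 := by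
    rcases Nat.lt_or_ge 1 d with hd1 | hd1
    · have h7 := Nat.pow_pred_clog_lt_self (b := 2) (by norm_num) hd1
      have h8 : 0 < Nat.clog 2 d := Nat.clog_pos (by norm_num) hd1
      have h9 : ((2 : ℝ) ^ (Nat.clog 2 d).pred) ≤ d := by exact_mod_cast h7.le
      have h10 := Real.log_le_log (by positivity) h9
      rw [Real.log_pow, Nat.pred_eq_sub_one, Nat.cast_sub h8] at h10
      push_cast at h10
      linarith
    · have : d = 1 := by omega
      subst this
      simp
      positivity
  nlinarith [(Nat.cast_nonneg (Nat.clog 2 d) : (0 : ℝ) ≤ _)]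

theorem communication_bounds {p : ℕ} (hp : 0 < p) {d k W T : ℕ} {δ : ℝ} (hk : 0 < k) (hkd : k ≤ d)
    (hdT : 2 ≤ d * T) (hδ : 0 < δ) (hδ1 : δ < 1) {Z 𝓗 𝓢 : Type*}
    (A : SketchedSGD d W T (sketchRows 1 d T δ) (256 * k) Z 𝓗 𝓢)
    (s : HashSeeds T (sketchRows 1 d T δ) 𝓗 𝓢) (ω : Samples d k T Z) (t : Fin T) :
    1 * (k * Real.log ((d : ℝ) * T / δ) * W) ≤ A.communication p s ω t ∧
      (A.communication p s ω t : ℝ)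
        ≤ (2100 * p + 8) * (k * Real.log ((d : ℝ) * T / δ) * W) := by
  obtain ⟨h1, h2⟩ := clog_le_four_mul_log (hk.trans_le hkd) hdT hδ hδ1
  rw [A.communication_eq]
  set ℓ := Real.log ((d : ℝ) * T / δ) with hℓ
  have hℓ0 : 0 ≤ ℓ := by linarith
  have h3 : ℓ ≤ sketchRows 1 d T δ := by
    rw [sketchRows, one_mul]
    exact Nat.le_ceil _
  have h4 : (sketchRows 1 d T δ : ℝ) ≤ ℓ + 1 := by
    rw [sketchRows, one_mul]
    exact (Nat.ceil_lt_add_one hℓ0).le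
  set n := sketchRows 1 d T δ
  have hp' : (1 : ℝ) ≤ p := by exact_mod_cast hp
  have hk0 : (0 : ℝ) ≤ k := k.cast_nonneg
  have hW0 : (0 : ℝ) ≤ W := W.cast_nonneg
  have hc0 : (0 : ℝ) ≤ Nat.clog 2 d := Nat.cast_nonneg _
  push_cast
  have e : (W : ℝ) * ((2 * n + 1) * (256 * k) * p + k * Nat.clog 2 d + k * p
      + k * (Nat.clog 2 d + p))
      = ((2 * n + 1) * 256 * p + 2 * Nat.clog 2 d + 2 * p) * (k * W) := by ring
  rw [e]
  have hkW : (0 : ℝ) ≤ k * W := by positivity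
  constructor
  · calc 1 * (k * ℓ * W) = ℓ * (k * W) := by ring
      _ ≤ _ := by
        refine mul_le_mul_of_nonneg_right ?_ hkW
        have : (n : ℝ) * 1 ≤ n * p := by gcongr
        nlinarith
  · calc _ ≤ ((2100 * p + 8) * ℓ) * (k * W) := by
          refine mul_le_mul_of_nonneg_right ?_ hkW
          have h5 : (2 * (n : ℝ) + 1) * 256 * p ≤ (2 * (ℓ + 1) + 1) * 256 * p := by gcongr
          have h6 : (p : ℝ) * 1 ≤ p * (2 * ℓ) := by gcongr
          linarith
      _ = _ := by ring

/-! ### The main theorem: choice of constants and union bound over the updates -/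

theorem theorem1 :
    ∃ (c₁ : ℝ) (c₂ : ℕ), 0 < c₁ ∧ 0 < c₂ ∧
      -- convergence
      (∀ β M : ℝ, 4 < β → ∃ C : ℝ, 0 < C ∧
        ∀ (d k W T : ℕ) (δ : ℝ), 0 < k → k ≤ d → 0 < W → 0 < T → 0 < δ → δ < 1 →
        ∀ (f : Vec d → ℝ) (L μ σ G : ℝ) (wstar : Vec d),
          0 < L → 0 < μ → 0 ≤ σ → 0 ≤ G →
          SmoothStronglyConvex f L μ → (∀ w, f wstar ≤ f w) →
        ∀ (Z : Type*) [MeasurableSpace Z] (ν : Measure Z) [IsProbabilityMeasure ν]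
          (𝓗 : Type*) [Fintype 𝓗] [Nonempty 𝓗] [MeasurableSpace 𝓗] [MeasurableSingletonClass 𝓗]
          (𝓢 : Type*) [Fintype 𝓢] [Nonempty 𝓢] [MeasurableSpace 𝓢] [MeasurableSingletonClass 𝓢]
          (A : SketchedSGD d W T (sketchRows c₁ d T δ) (c₂ * k) Z 𝓗 𝓢),
          KWiseIndependent 2 A.bucketFamily → KWiseIndependent 4 A.signFamily →
          8 ≤ A.γ * μ → A.γ * μ ≤ M →
          2 + (d : ℝ) * (1 + β) / (k * (1 + 4 * β / ((β - 4) * (β + 1) ^ 2))) < A.ξ →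
          A.ξ ≤ M * (d / k) →
          (∀ t i, Measurable (Function.uncurry (A.oracle t i))) →
          (∀ (s : HashSeeds T (sketchRows c₁ d T δ) 𝓗 𝓢) (t : Fin T),
            ∀ᵐ ω ∂(samplesLaw d k T ν),
              GoodGradientAt ν f (A.meanOracle t) σ G (A.iterate s ω t)) →
          1 - δ ≤ (ProbabilityTheory.uniformOn
              (Set.univ : Set (HashSeeds T (sketchRows c₁ d T δ) 𝓗 𝓢))).real
            {s | Integrable (fun ω => f (A.output s ω)) (samplesLaw d k T ν) ∧
              ∫ ω, f (A.output s ω) ∂(samplesLaw d k T ν) - f wstar ≤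
                C * (σ ^ 2 / (μ * T) + d ^ 2 * G ^ 2 * L / (k ^ 2 * μ ^ 2 * T ^ 2)
                  + d ^ 3 * G ^ 3 / (k ^ 3 * μ * T ^ 3))}) ∧
      -- communication
      (∀ p : ℕ, 0 < p → ∃ lo hi : ℝ, 0 < lo ∧ 0 < hi ∧
        ∀ (d k W T : ℕ) (δ : ℝ), 0 < k → k ≤ d → 0 < W → 2 ≤ d * T → 0 < δ → δ < 1 →
        ∀ (Z 𝓗 𝓢 : Type*) (A : SketchedSGD d W T (sketchRows c₁ d T δ) (c₂ * k) Z 𝓗 𝓢)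
          (s : HashSeeds T (sketchRows c₁ d T δ) 𝓗 𝓢) (ω : Samples d k T Z) (t : Fin T),
          lo * (k * Real.log ((d : ℝ) * T / δ) * W) ≤ A.communication p s ω t ∧
          (A.communication p s ω t : ℝ) ≤ hi * (k * Real.log ((d : ℝ) * T / δ) * W)) := by
  refine ⟨1, 256, one_pos, by norm_num, ?_, ?_⟩
  · intro β M hβ
    set c := (1 + β) / (1 + 4 * β / ((β - 4) * (β + 1) ^ 2)) with hc
    have hβ4 : 0 < β - 4 := by linarith
    have hc0 : 0 < c := by positivity
    -- The maximum with 1 keeps the constant positive for every `M`, including those for which 8 ≤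
    -- γμ ≤ M is impossible.
    refine ⟨max (6 * (M ^ 3 / 2 + M * (1 + M)
      + (5 * (16384 * (1 + 384 / c) ^ 2) + 8) * M ^ 2) + 1) 1, by positivity, ?_⟩
    intro d k W T δ hk hkd hW hT hδ hδ1 f L μ σ G wstar hL hμ hσ hG hf hmin Z _ ν _
      𝓗 _ _ _ _ 𝓢 _ _ _ _ A hb hs hγ8 hγM hξ hξM hA hgood
    have hk' : (0 : ℝ) < k := by exact_mod_cast hk
    have hd' : (0 : ℝ) < d := by exact_mod_cast hk.trans_le hkd
    -- The lower bound on ξ enters only in this form, with `c` depending on β alone; the summand 2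
    -- is discarded.
    have hξ' : c * ((d : ℝ) / k) ≤ A.ξ := by
      have : c * ((d : ℝ) / k)
          = (d : ℝ) * (1 + β) / (k * (1 + 4 * β / ((β - 4) * (β + 1) ^ 2))) := by
        rw [hc, div_mul_div_comm]
        congr 1 <;> ring
      linarith
    have hξ0 : 0 < A.ξ := lt_of_lt_of_le (by positivity) hξ'
    have hn := le_four_pow_sketchRows (hk.trans_le hkd) hT hδ
    classical
    refine one_sub_le_uniformOn_univ_real
      (bad := Finset.univ.biUnion fun t => A.failingSeeds k ν t) ?_ fun s hs' => ?_
    · calc ((Finset.univ.biUnion fun t => A.failingSeeds k ν t).card : ℝ)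
          ≤ ∑ t, ((A.failingSeeds k ν t).card : ℝ) := by exact_mod_cast Finset.card_biUnion_le
        _ ≤ ∑ _t : Fin T, δ / T * Fintype.card (HashSeeds T (sketchRows 1 d T δ) 𝓗 𝓢) :=
            Finset.sum_le_sum fun t _ =>
              A.card_failingSeeds_le hW hk hkd hT hδ hn hb hs hA hgood t
        _ = δ * Fintype.card (HashSeeds T (sketchRows 1 d T δ) 𝓗 𝓢) := by
            have hT' : (T : ℝ) ≠ 0 := by positivity
            rw [Finset.sum_const, nsmul_eq_mul, Finset.card_univ, Fintype.card_fin]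
            field_simp
    · refine ⟨(A.integrable_output hkd hT hf hμ hG hmin hξ0 hA (hgood s)).1, ?_⟩
      refine (A.integral_output_le hW hk hkd hT hf hμ hL hG hmin hc0 hγ8 hγM hξ' hξM hA (hgood s)
        fun t => ?_).trans ?_
      · by_contra! h
        exact hs' (Finset.mem_biUnion.mpr
          ⟨t, Finset.mem_univ t, Finset.mem_filter.mpr ⟨Finset.mem_univ s, h⟩⟩)
      · have e : ((d : ℝ) / k) ^ 2 * G ^ 2 * L / (μ ^ 2 * T ^ 2)
            = (d : ℝ) ^ 2 * G ^ 2 * L / (k ^ 2 * μ ^ 2 * T ^ 2) := by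
          field_simp
        rw [e]
        refine mul_le_mul (le_max_left _ _) ?_ (by positivity) (by positivity)
        -- The nonnegative cubic term is simply added to a bound that already holds without it.
        exact le_add_of_nonneg_right (by positivity)
  · intro p hp
    refine ⟨1, 2100 * p + 8, one_pos, by positivity, ?_⟩
    intro d k W T δ hk hkd hW hdT hδ hδ1 Z 𝓗 𝓢 A s ω t
    exact communication_bounds hp hk hkd hdT hδ hδ1 A s ω t
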